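/- Let $\mathbb X=\{1,2,3,\dots\}$ with the hierarchical distance $d(i,j)=\min\{n\ge 0:\exists k\ge 0,\ i,j\in(k2^n,(k+1)2^n]\}$. Let $\overline W>0$ and $\rho>1$, and set $W_{ij}=\overline W(2\rho)^{-d(i,j)}$ for $i\ne j$, $W_{ii}=0$. Put $\Lambda_n=\{1,\dots,2^n\}$ and $\widetilde\Lambda_n=\Lambda_n\cup\{\delta_n\}$, where $\widetilde\Lambda_n$ carries the weights $W_{ij}$ for $i,j\in\Lambda_n$ and $W_{i\delta_n}=W_{\delta_n i}=\sum_{j\notin\Lambda_n}W_{ij}$ for $i\in\Lambda_n$. For a finite set $V$ with symmetric weights $W$ (zero on the diagonal) and $\beta\in\mathbb R^V$, let $H_\beta$ be the matrix with diagonal entries $2\beta_i$ and off-diagonal entries $-W_{ij}$, and let $$d\nu^W(\beta)=\Big(\tfrac{2}{\pi}\Big)^{|V|/2}\mathbf 1_{\{H_\beta>0\}}\,e^{-\frac12\langle 1,H_\beta 1\rangle}\,\frac{1}{\sqrt{\det H_\beta}}\prod_{i\in V}d\beta_i .$$ Let $(\beta_i)_{i\in\mathbb X}$ be the $\beta$-field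 of the $H^{2|2}$-model on $\mathbb X$ and let $\beta_{\delta_n}$, $n\ge 0$, be the potentials at the boundary vertices, all on one probability space. That is, for every $n\ge 0$ the vector $((\beta_i)_{i\in\Lambda_n},\beta_{\delta_n})$ has law $\nu^{W}$ on the augmented graph $\widetilde\Lambda_n$. Let $H^{(n)}$ be the matrix $H_\beta$ on $\widetilde\Lambda_n$, let $G^{(n)}=(H^{(n)})^{-1}$, and let $\psi^{(n)}_i=G^{(n)}(i,\delta_n)/G^{(n)}(\delta_n,\delta_n)$ for $i\in\Lambda_n$ and $\psi^{(n)}_i=1$ for $i\notin\Lambda_n$. Let $g_0$ be the identity of $\mathbb X$. For $n\ge1$ let $g_n$ be the bijection of $\mathbb X$ with $g_n(i)=i+2^n$ for $1\le i\le 2^n$, $g_n(i)=i-2^n$ for $2^n<i\le 2^{n+1}$, and $g_n(i)=i$ for $i>2^{n+1}$. Let $\mathbf G$ be the group generated by $(g_n)_{n\ge0}$, and let $\mathrm{Aut}(\mathbb X)$ be the group of all bijections of $\mathbb X$ that preserve $d$. A group $\Gamma$ of bijections of $\mathbb X$ acts on $\mathbb R^{\mathbb X}$ by $(x_i)_i\mapsto(x_{\sigma(i)})_i$,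 $\sigma\in\Gamma$. A random field on $\mathbb X$ is called stationary under $\Gamma$ if its law is invariant under this action. It is called ergodic under $\Gamma$ if every Borel set of $\mathbb R^{\mathbb X}$ that is invariant, up to null sets of the law, under every element of $\Gamma$ has probability $0$ or $1$. Then: 1. The field $(\beta_i)_{i\in\mathbb X}$ is stationary and ergodic under $\mathbf G$, and also under $\mathrm{Aut}(\mathbb X)$. 2. The field is mixing along $(g_n)$: for all Borel sets $E,F\subset\mathbb R^{\mathbb X}$, $$\lim_{n\to\infty}\mathbb P\big[(\beta_{g_n(i)})_{i}\in F,\ (\beta_i)_i\in E\big]=\mathbb P[(\beta_i)_i\in F]\;\mathbb P[(\beta_i)_i\in E].$$ 3. Almost surely, for every $i\in\mathbb X$ the limit $\psi_i=\lim_{n\to\infty}\psi^{(n)}_i$ exists in $\mathbb R$, and the field $(\psi_i)_{i\in\mathbb X}$ is stationary and ergodic under $\mathbf G$, and also under $\mathrm{Aut}(\mathbb X)$. -/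

import Mathlib

open MeasureTheory ProbabilityTheory Filter Topology

noncomputable section

namespace DysonH22

/-! ### The `H^{2|2}`-model on a finite weighted graph -/

section FiniteGraph

variable {V : Type*} [Fintype V] [DecidableEq V]

/-- The Schrödinger operator `(H_β f)(i) = 2 β_i f(i) - ∑_j W_{ij} f(j)` as a matrix; the weights
`W` are symmetric with `W_{ii} = 0`. -/
def schrodinger (W : V → V → ℝ) (β : V → ℝ) : Matrix V V ℝ :=
  Matrix.diagonal (fun i => 2 * β i) - Matrix.of W

/-- The Green matrix `G = H_β⁻¹`. -/
def green (W : V → V → ℝ) (β : V → ℝ) : Matrix V V ℝ :=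
  (schrodinger W β)⁻¹

open Classical in
/-- The density
`√(2/π)^{|V|} 1_{H_β > 0} exp(-⟨1, H_β 1⟩ / 2) / √(det H_β)` of the `H^{2|2}`-model. -/
def h22Density (W : V → V → ℝ) (β : V → ℝ) : ℝ :=
  if (schrodinger W β).PosDef then
    Real.sqrt (2 / Real.pi) ^ Fintype.card V
      * Real.exp (-(1 / 2) * ∑ i, ∑ j, schrodinger W β i j)
      / Real.sqrt (schrodinger W β).det
  else 0

/-- The law `ν^W` of the random potential `β` of the `H^{2|2}`-model on the finite weighted graph
`(V, W)`. -/
def h22Measure (W : V → V → ℝ) : Measure (V → ℝ) :=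
  volume.withDensity fun β => ENNReal.ofReal (h22Density W β)

end FiniteGraph

/-! ### The Dyson hierarchical lattice, with vertex set `ℕ+ = {1, 2, …}` -/

/-- The hierarchical distance: the least `n` such that `i` and `j` lie in a common block
`{k 2^n + 1, …, (k + 1) 2^n}`. -/
def dysonDist (i j : ℕ+) : ℕ :=
  sInf {n : ℕ | ∃ k : ℕ, (k * 2 ^ n < (i : ℕ) ∧ (i : ℕ) ≤ (k + 1) * 2 ^ n) ∧
    (k * 2 ^ n < (j : ℕ) ∧ (j : ℕ) ≤ (k + 1) * 2 ^ n)}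

/-- The weights `W_{ij} = Wbar (2ρ)^{-d(i,j)}` for `i ≠ j`, and `W_{ii} = 0`. -/
def dysonWeight (Wbar ρ : ℝ) (i j : ℕ+) : ℝ :=
  if i = j then 0 else Wbar * ((2 * ρ) ^ dysonDist i j)⁻¹

/-- The ball `Λ_n = {1, …, 2^n}`. -/
def ball (n : ℕ) : Finset ℕ+ :=
  Finset.Icc 1 (2 ^ n)

/-- The weights on the augmented graph `Λ_n ∪ {δ_n}`, where `none` stands for `δ_n`: each
`i ∈ Λ_n` is joined to `δ_n` with weight `∑_{j ∉ Λ_n} W_{ij}`. -/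
def wiredWeight (Wbar ρ : ℝ) (n : ℕ) : Option (ball n) → Option (ball n) → ℝ
  | some i, some j => dysonWeight Wbar ρ i j
  | some i, none => ∑' j : {j : ℕ+ // j ∉ ball n}, dysonWeight Wbar ρ i j
  | none, some i => ∑' j : {j : ℕ+ // j ∉ ball n}, dysonWeight Wbar ρ i j
  | none, none => 0

/-- The potential on the augmented graph `Λ_n ∪ {δ_n}`: the restriction of `β` to `Λ_n`, together
with the value `b` at `δ_n`. -/
def augment (n : ℕ) (β : ℕ+ → ℝ) (b : ℝ) : Option (ball n) → ℝ
  | some i => β i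
  | none => b

/-- `ψ^{(n)}_i = G^{(n)}(i, δ_n) / G^{(n)}(δ_n, δ_n)` for `i ∈ Λ_n`, and `ψ^{(n)}_i = 1`
otherwise, where `G^{(n)}` is the Green matrix on the augmented graph with potential `β` on `Λ_n`
and `b` at `δ_n`. -/
def psiApprox (Wbar ρ : ℝ) (n : ℕ) (β : ℕ+ → ℝ) (b : ℝ) (i : ℕ+) : ℝ :=
  if hi : i ∈ ball n then
    green (wiredWeight Wbar ρ n) (augment n β b) (some ⟨i, hi⟩) none /
      green (wiredWeight Wbar ρ n) (augment n β b) none none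
  else 1

/-! ### Automorphisms -/

/-- For `n ≥ 1`, the map exchanging the blocks `{1, …, 2^n}` and `{2^n + 1, …, 2^(n+1)}` by
translation and fixing all other vertices. -/
def swapFun (n : ℕ) (i : ℕ+) : ℕ+ :=
  if i ≤ 2 ^ n then i + 2 ^ n else if i ≤ 2 ^ (n + 1) then i - 2 ^ n else i

theorem swapFun_involutive (n : ℕ) : Function.Involutive (swapFun n) := by
  intro i
  have key : ∀ a b : ℕ+, a ≤ b ↔ (a : ℕ) ≤ b := fun a b => Iff.rfl
  apply PNat.coe_injective
  have hi := i.pos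
  have h2 : 0 < 2 ^ n := by positivity
  have hs : ((2 ^ (n + 1) : ℕ+) : ℕ) = 2 * 2 ^ n := by push_cast; ring
  have hn : ((2 ^ n : ℕ+) : ℕ) = 2 ^ n := by push_cast; rfl
  unfold swapFun
  split_ifs with h1 h3 h4 h5 h6 h7 <;>
    simp only [key, PNat.add_coe, PNat.sub_coe, hs, hn, ← PNat.coe_lt_coe] at * <;>
    (try split_ifs at *) <;> omega

/-- The automorphisms `g_n`: `g_0` is the identity, and `g_n` exchanges the two blocks of size
`2^n` in `{1, …, 2^(n+1)}` for `n ≥ 1`. -/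
def swap (n : ℕ) : Equiv.Perm ℕ+ :=
  if n = 0 then 1 else (swapFun_involutive n).toPerm

/-- The group generated by the `g_n`. -/
def swapGroup : Subgroup (Equiv.Perm ℕ+) :=
  Subgroup.closure (Set.range swap)

/-- The group of all automorphisms of the Dyson lattice: the bijections that preserve the
hierarchical distance. -/
def autGroup : Subgroup (Equiv.Perm ℕ+) where
  carrier := {σ | ∀ i j, dysonDist (σ i) (σ j) = dysonDist i j}
  mul_mem' := by
    intro σ τ hσ hτ i j
    exact (hσ (τ i) (τ j)).trans (hτ i j)
  one_mem' := fun _ _ => rfl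
  inv_mem' := by
    intro σ hσ i j
    have h := hσ (σ⁻¹ i) (σ⁻¹ j)
    simpa using h.symm

/-- The law `μ` of a real field on `ℕ+` is stationary and ergodic for the group `Γ`, which acts by
`(σ • f) i = f (σ i)`. -/
def StationaryErgodic (Γ : Subgroup (Equiv.Perm ℕ+)) (μ : Measure (ℕ+ → ℝ)) : Prop :=
  ErgodicSMul (DomMulAct Γ) (ℕ+ → ℝ) μ

end DysonH22

end

open MeasureTheory ProbabilityTheory Filter Topology

noncomputable section

namespace DysonH22

set_option linter.unusedSectionVars false

/-! ### Generalised `H^{2|2}` densities -/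

section Pinned

open Matrix

variable {V : Type*} [Fintype V] [DecidableEq V]

/-! Everything rests on one explicit family of laws. The restriction of an `H^{2|2}` potential to a
vertex set has density `pinnedDensity W R`, with `W` the weights inside the set and `R` the total
weights in the whole graph. Restricting further changes none of the surviving values of `W` and `R`,
so the family is consistent as soon as one vertex can be integrated out. Let s be the Schur
complement at that vertex. The density is that of the other vertices times √(2/π) exp(-(s -
a)²/(2s)) / √s, where a depends on the other potentials only (`pinnedDensity_option`). For a ≥ 0
this kernel has mass two in s, and for a > 0 it still has mass two after multiplication by a/s. The
first fact gives the marginals (`map_pinnedMeasure`). The value at the removed vertex of the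
solution ψ of H_β ψ = η, with η the boundary weight, is a/s, so the second fact gives a martingale
property for ψ (`lintegral_greenField_comp`).

Wiring a ball to δ_n preserves the total weights in the ball. The finite-dimensional marginals of
the β-field are therefore pinned laws with the Dyson weights, which automorphisms preserve: this is
stationarity. The weights between a fixed finite set and the image under g_n of another one tend to
zero, while `R` stays the same. The densities then pass to the limit, Fatou's lemma turns this into
setwise convergence (`tendsto_pinnedMeasure`), and the limit law is a product. A π-system argument
extends the asymptotic independence from cylinders to Borel sets. Since every g_n lies in both
groups, an invariant set E satisfies μ(E) = μ(E)², which is ergodicity.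

Finally, ψ^{(n)} solves H_β ψ = η on Λ_n and does not depend on the potential at δ_n. At each site
it is eventually a nonnegative martingale of mean one, so it converges almost surely. An
automorphism preserves Λ_n for large n; hence the limit is an equivariant measurable function of β
and inherits stationarity and ergodicity (`StationaryErgodic.map`). -/

/-- The weight joining `i` to the exterior of `V`, when `R i` is the total weight at `i`. -/
def boundaryWeight (W : V → V → ℝ) (R : V → ℝ) (i : V) : ℝ :=
  R i - ∑ j, W i j

/-- The solution `ψ` of `H_β ψ = η`, where `η` is the boundary weight. -/
def greenField (W : V → V → ℝ) (R β : V → ℝ) : V → ℝ :=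
  green W β *ᵥ boundaryWeight W R

open Classical in
/-- The density of the restriction to `V` of the potential of an `H^{2|2}`-model on a larger
graph, where `R` is the total weight in that graph. -/
def pinnedDensity (W : V → V → ℝ) (R β : V → ℝ) : ℝ :=
  if (schrodinger W β).PosDef then
    Real.sqrt (2 / Real.pi) ^ Fintype.card V
      * Real.exp (-∑ i, β i + ∑ i, R i - (1 / 2) * ∑ i, ∑ j, W i j
        - (1 / 2) * (boundaryWeight W R ⬝ᵥ greenField W R β))
      / Real.sqrt (schrodinger W β).det
  else 0

/-- The measure with density `pinnedDensity W R`. -/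
def pinnedMeasure (W : V → V → ℝ) (R : V → ℝ) : Measure (V → ℝ) :=
  volume.withDensity fun β => ENNReal.ofReal (pinnedDensity W R β)

theorem pinnedDensity_of_posDef {W : V → V → ℝ} {β : V → ℝ} (R : V → ℝ)
    (h : (schrodinger W β).PosDef) :
    pinnedDensity W R β = Real.sqrt (2 / Real.pi) ^ Fintype.card V
      * Real.exp (-∑ i, β i + ∑ i, R i - (1 / 2) * ∑ i, ∑ j, W i j
        - (1 / 2) * (boundaryWeight W R ⬝ᵥ greenField W R β))
      / Real.sqrt (schrodinger W β).det :=
  if_pos h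

theorem pinnedDensity_of_not_posDef {W : V → V → ℝ} {β : V → ℝ} (R : V → ℝ)
    (h : ¬ (schrodinger W β).PosDef) : pinnedDensity W R β = 0 :=
  if_neg h

theorem sum_schrodinger (W : V → V → ℝ) (β : V → ℝ) :
    ∑ i, ∑ j, schrodinger W β i j = 2 * ∑ i, β i - ∑ i, ∑ j, W i j := by
  simp [schrodinger, Matrix.diagonal_apply, Finset.sum_sub_distrib, Finset.mul_sum]

/-- Without exterior weights the law of the `H^{2|2}`-model is recovered. -/
theorem h22Measure_eq_pinnedMeasure (W : V → V → ℝ) :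
    h22Measure W = pinnedMeasure W fun i => ∑ j, W i j := by
  unfold h22Measure pinnedMeasure
  congr 1
  ext β
  have h0 : boundaryWeight W (fun i => ∑ j, W i j) = 0 := by ext; simp [boundaryWeight]
  unfold h22Density pinnedDensity
  rw [h0, sum_schrodinger]
  split_ifs
  · congr 4
    simp
    ring
  · rfl

theorem schrodinger_isHermitian {W : V → V → ℝ} (hW : ∀ i j, W i j = W j i) (β : V → ℝ) :
    (schrodinger W β).IsHermitian := by
  ext i j
  by_cases h : i = j
  · simp [schrodinger, h]
  · simp [schrodinger, h, Ne.symm h, hW i j]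

theorem schrodinger_mulVec_apply (W : V → V → ℝ) (β y : V → ℝ) (i : V) :
    (schrodinger W β *ᵥ y) i = 2 * β i * y i - ∑ j, W i j * y j := by
  simp [schrodinger, sub_mulVec, mulVec_diagonal]
  rfl

theorem schrodinger_mulVec_green {W : V → V → ℝ} {β : V → ℝ} (h : (schrodinger W β).PosDef)
    (v : V → ℝ) : schrodinger W β *ᵥ (green W β *ᵥ v) = v := by
  rw [mulVec_mulVec, green, mul_nonsing_inv _ ((isUnit_iff_isUnit_det _).1 h.isUnit), one_mulVec]

theorem eq_green_mulVec {W : V → V → ℝ} {β : V → ℝ} (h : (schrodinger W β).PosDef)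
    {u v : V → ℝ} (huv : schrodinger W β *ᵥ u = v) : u = green W β *ᵥ v := by
  rw [← huv, mulVec_mulVec, green, nonsing_inv_mul _ ((isUnit_iff_isUnit_det _).1 h.isUnit),
    one_mulVec]

theorem dotProduct_schrodinger_comm {W : V → V → ℝ} (hW : ∀ i j, W i j = W j i) (β u v : V → ℝ) :
    u ⬝ᵥ (schrodinger W β *ᵥ v) = (schrodinger W β *ᵥ u) ⬝ᵥ v := by
  rw [dotProduct_mulVec, ← mulVec_transpose]
  congr 2
  simpa using (schrodinger_isHermitian hW β).eq

theorem dotProduct_green_comm {W : V → V → ℝ} (hW : ∀ i j, W i j = W j i) {β : V → ℝ}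
    (h : (schrodinger W β).PosDef) (u v : V → ℝ) :
    u ⬝ᵥ (green W β *ᵥ v) = v ⬝ᵥ (green W β *ᵥ u) := by
  conv_lhs => rw [← schrodinger_mulVec_green h u]
  rw [← dotProduct_schrodinger_comm hW, schrodinger_mulVec_green h, dotProduct_comm]

/-- A positive definite Schrödinger matrix has a nonnegative inverse. -/
theorem green_mulVec_nonneg {W : V → V → ℝ} (hW0 : ∀ i j, 0 ≤ W i j)
    {β : V → ℝ} (h : (schrodinger W β).PosDef) {v : V → ℝ} (hv : ∀ i, 0 ≤ v i) (i : V) :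
    0 ≤ (green W β *ᵥ v) i := by
  set u := green W β *ᵥ v with hu
  have hHu : schrodinger W β *ᵥ u = v := schrodinger_mulVec_green h v
  -- Test with the negative part m of u: since W ≥ 0, ⟨m, Hm⟩ ≤ -⟨m, Hu⟩ = -⟨m, v⟩ ≤ 0, which
  -- positive definiteness allows only for m = 0.
  set m : V → ℝ := fun i => (u i)⁻ with hm
  by_contra hneg
  have hne : m ≠ 0 := by
    intro h0
    have := congrFun h0 i
    simp only [hm, Pi.zero_apply, negPart_eq_zero] at this
    exact hneg this
  have hpos := h.dotProduct_mulVec_pos hne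
  have hle : m ⬝ᵥ (schrodinger W β *ᵥ m) ≤ - (m ⬝ᵥ v) := by
    rw [← hHu]
    simp only [dotProduct, ← Finset.sum_neg_distrib]
    refine Finset.sum_le_sum fun i _ => ?_
    rw [schrodinger_mulVec_apply, schrodinger_mulVec_apply]
    have hmi : 0 ≤ m i := negPart_nonneg _
    have h1 : m i * u i = - (m i * m i) := by
      rcases le_total 0 (u i) with h | h
      · simp [hm, negPart_eq_zero.2 h]
      · simp only [hm, negPart_eq_neg.2 h]
        ring
    have h2 : ∑ j, W i j * m j ≥ - ∑ j, W i j * u j := by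
      rw [← Finset.sum_neg_distrib]
      refine Finset.sum_le_sum fun j _ => ?_
      have : -u j ≤ m j := neg_le_negPart _
      nlinarith [hW0 i j]
    linear_combination mul_le_mul_of_nonneg_left h2 hmi + 2 * β i * h1
  have : 0 ≤ m ⬝ᵥ v := Finset.sum_nonneg fun i _ => mul_nonneg (negPart_nonneg _) (hv i)
  simp only [star_trivial] at hpos
  linarith

theorem greenField_nonneg {W : V → V → ℝ} (hW0 : ∀ i j, 0 ≤ W i j) {R : V → ℝ}
    (hR : ∀ i, 0 ≤ boundaryWeight W R i) {β : V → ℝ} (h : (schrodinger W β).PosDef) (i : V) :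
    0 ≤ greenField W R β i :=
  green_mulVec_nonneg hW0 h hR i

end Pinned

/-! ### Adjoining one vertex -/

section OptionVertex

open Matrix

variable {U : Type*} [Fintype U] [DecidableEq U]

/-- The weights between the new vertex `none` and the old ones. -/
def rootWeight (W : Option U → Option U → ℝ) (i : U) : ℝ := W none (some i)

/-- The restriction of the weights to the old vertices. -/
def oldWeight (W : Option U → Option U → ℝ) (i j : U) : ℝ := W (some i) (some j)

/-- The Schur complement of the old vertices in the Schrödinger matrix, for the potential `b` at
the new vertex and `β` at the old ones. -/
def schurComplement (W : Option U → Option U → ℝ) (β : U → ℝ) (b : ℝ) : ℝ :=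
  2 * b - rootWeight W ⬝ᵥ (green (oldWeight W) β *ᵥ rootWeight W)

/-- The potential with value `b` at the new vertex and `β` at the old ones. -/
def extendPotential (β : U → ℝ) (b : ℝ) : Option U → ℝ := fun i => i.elim b β

/-- The product of the Schur complement and of the value of `greenField` at the new vertex. -/
def rootDrift (W : Option U → Option U → ℝ) (R : Option U → ℝ) (β : U → ℝ) : ℝ :=
  boundaryWeight W R none +
    rootWeight W ⬝ᵥ (green (oldWeight W) β *ᵥ fun i => boundaryWeight W R (some i))

variable {W : Option U → Option U → ℝ} {R : Option U → ℝ} {β : U → ℝ} {b : ℝ}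

theorem schrodinger_mulVec_some (hW : ∀ i j, W i j = W j i) (y : Option U → ℝ) (i : U) :
    (schrodinger W (extendPotential β b) *ᵥ y) (some i) =
      (schrodinger (oldWeight W) β *ᵥ fun j => y (some j)) i - rootWeight W i * y none := by
  rw [schrodinger_mulVec_apply, schrodinger_mulVec_apply, Fintype.sum_option]
  simp only [extendPotential, oldWeight, rootWeight, Option.elim, hW (some i) none]
  ring

theorem schrodinger_mulVec_none (hW0 : W none none = 0) (y : Option U → ℝ) :
    (schrodinger W (extendPotential β b) *ᵥ y) none =
      2 * b * y none - rootWeight W ⬝ᵥ fun j => y (some j) := by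
  rw [schrodinger_mulVec_apply, Fintype.sum_option, hW0]
  simp [extendPotential, rootWeight, dotProduct]

theorem schrodinger_submatrix_some :
    (schrodinger W (extendPotential β b)).submatrix some some = schrodinger (oldWeight W) β := by
  ext i j
  simp [schrodinger, extendPotential, oldWeight, Matrix.diagonal_apply]

theorem dotProduct_option (x y : Option U → ℝ) :
    x ⬝ᵥ y = x none * y none + (fun i => x (some i)) ⬝ᵥ fun i => y (some i) := by
  simp [dotProduct, Fintype.sum_option]

/-- Completing the square in the old coordinates; the remainder is the Schur complement. -/
theorem quadraticForm_option (hW : ∀ i j, W i j = W j i) (hW0 : W none none = 0)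
    (h : (schrodinger (oldWeight W) β).PosDef) (y : Option U → ℝ) :
    y ⬝ᵥ (schrodinger W (extendPotential β b) *ᵥ y) =
      ((fun i => y (some i)) - y none • (green (oldWeight W) β *ᵥ rootWeight W)) ⬝ᵥ
        (schrodinger (oldWeight W) β *ᵥ
          ((fun i => y (some i)) - y none • (green (oldWeight W) β *ᵥ rootWeight W)))
      + y none ^ 2 * schurComplement W β b := by
  have hWo : ∀ i j, oldWeight W i j = oldWeight W j i := fun i j => hW _ _
  set w := rootWeight W
  set u := green (oldWeight W) β *ᵥ w with hu
  set A := schrodinger (oldWeight W) β with hA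
  set z : U → ℝ := fun i => y (some i)
  have hAu : A *ᵥ u = w := schrodinger_mulVec_green h w
  have h1 : u ⬝ᵥ (A *ᵥ z) = w ⬝ᵥ z := by
    rw [hA, dotProduct_schrodinger_comm hWo, ← hA, hAu]
  rw [dotProduct_option, schrodinger_mulVec_none hW0]
  have h2 : (fun i => (schrodinger W (extendPotential β b) *ᵥ y) (some i)) =
      A *ᵥ z - y none • w := by
    ext i
    rw [schrodinger_mulVec_some hW]
    simp [hA, z, w, mul_comm]
  rw [h2, mulVec_sub, mulVec_smul, hAu]
  simp only [schurComplement, dotProduct_sub, sub_dotProduct, smul_dotProduct, dotProduct_smul,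
    h1, smul_eq_mul]
  rw [dotProduct_comm z w, dotProduct_comm u w]
  change y none * (2 * b * y none - w ⬝ᵥ z) + _ = _
  ring

theorem posDef_option_iff (hW : ∀ i j, W i j = W j i) (hW0 : W none none = 0) :
    (schrodinger W (extendPotential β b)).PosDef ↔
      (schrodinger (oldWeight W) β).PosDef ∧ 0 < schurComplement W β b := by
  constructor
  · intro h
    have h1 : (schrodinger (oldWeight W) β).PosDef := by
      rw [← schrodinger_submatrix_some (b := b)]
      exact h.submatrix (Option.some_injective _)
    refine ⟨h1, ?_⟩
    -- The vector for which the completed square vanishes.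
    set y : Option U → ℝ := fun i => i.elim 1 (green (oldWeight W) β *ᵥ rootWeight W) with hy
    have hne : y ≠ 0 := fun h0 => one_ne_zero (congrFun h0 none)
    have := h.dotProduct_mulVec_pos hne
    rw [star_trivial, quadraticForm_option hW hW0 h1] at this
    have hz : (fun i => y (some i)) - y none • (green (oldWeight W) β *ᵥ rootWeight W) = 0 := by
      ext i
      simp [hy]
    rw [hz] at this
    simpa [hy] using this
  · rintro ⟨h1, h2⟩
    refine .of_dotProduct_mulVec_pos (schrodinger_isHermitian hW _) fun y hy => ?_
    rw [star_trivial, quadraticForm_option hW hW0 h1]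
    by_cases hy0 : y none = 0
    · have hz : (fun i => y (some i)) ≠ 0 := by
        intro h0
        refine hy (funext fun i => ?_)
        cases i with
        | none => exact hy0
        | some i => exact congrFun h0 i
      simpa [hy0] using h1.dotProduct_mulVec_pos hz
    · have h3 := h1.posSemidef.dotProduct_mulVec_nonneg
        ((fun i => y (some i)) - y none • (green (oldWeight W) β *ᵥ rootWeight W))
      rw [star_trivial] at h3
      have : 0 < y none ^ 2 * schurComplement W β b := by positivity
      linarith

theorem det_schrodinger_option (hW : ∀ i j, W i j = W j i) (hW0 : W none none = 0)
    (h : (schrodinger (oldWeight W) β).PosDef) :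
    (schrodinger W (extendPotential β b)).det =
      (schrodinger (oldWeight W) β).det * schurComplement W β b := by
  set A := schrodinger (oldWeight W) β with hA
  have : Invertible A := h.isUnit.invertible
  have hre : (schrodinger W (extendPotential β b)).submatrix (Equiv.optionEquivSumPUnit.{0} U).symm
      (Equiv.optionEquivSumPUnit.{0} U).symm =
      fromBlocks A (-replicateCol Unit (rootWeight W)) (-replicateRow Unit (rootWeight W))
        (of fun _ _ => 2 * b) := by
    ext i j
    rcases i with i | i <;> rcases j with j | j <;>
      simp [schrodinger, extendPotential, rootWeight, oldWeight, hA, hW0, hW _ none,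
        Matrix.diagonal_apply]
  rw [← det_submatrix_equiv_self (Equiv.optionEquivSumPUnit.{0} U).symm, hre, det_fromBlocks₁₁]
  congr 1
  rw [det_unique]
  simp only [invOf_eq_nonsing_inv, schurComplement, green, ← hA, Matrix.neg_mul, Matrix.mul_neg,
    Matrix.sub_apply, neg_neg, of_apply]
  congr 1
  rw [Matrix.mul_assoc]
  simp [Matrix.mul_apply, dotProduct, mulVec]

/-- The equations at the old vertices express the solution through its value t at the new vertex;
the equation there then reads s t = a, with s the Schur complement and a the drift. -/
theorem greenField_option (hW : ∀ i j, W i j = W j i) (hW0 : W none none = 0)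
    (h : (schrodinger (oldWeight W) β).PosDef) (hs : 0 < schurComplement W β b) :
    greenField W R (extendPotential β b) = fun i => i.elim (rootDrift W R β / schurComplement W β b)
      ((green (oldWeight W) β *ᵥ fun i => boundaryWeight W R (some i)) +
        (rootDrift W R β / schurComplement W β b) • (green (oldWeight W) β *ᵥ rootWeight W)) := by
  symm
  refine eq_green_mulVec ((posDef_option_iff hW hW0).2 ⟨h, hs⟩) (funext fun i => ?_)
  set t := rootDrift W R β / schurComplement W β b with ht
  have hts : t * schurComplement W β b = rootDrift W R β := div_mul_cancel₀ _ hs.ne'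
  cases i with
  | none =>
    rw [schrodinger_mulVec_none hW0]
    simp only [Option.elim, schurComplement, rootDrift] at hts ⊢
    rw [show (fun j => ((green (oldWeight W) β *ᵥ fun i => boundaryWeight W R (some i)) +
        t • (green (oldWeight W) β *ᵥ rootWeight W)) j) =
        ((green (oldWeight W) β *ᵥ fun i => boundaryWeight W R (some i)) +
        t • (green (oldWeight W) β *ᵥ rootWeight W)) from rfl, dotProduct_add, dotProduct_smul,
        smul_eq_mul]
    linarith
  | some i =>
    rw [schrodinger_mulVec_some hW]
    simp only [Option.elim]
    rw [show (fun j => ((green (oldWeight W) β *ᵥ fun i => boundaryWeight W R (some i)) +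
        t • (green (oldWeight W) β *ᵥ rootWeight W)) j) =
        ((green (oldWeight W) β *ᵥ fun i => boundaryWeight W R (some i)) +
        t • (green (oldWeight W) β *ᵥ rootWeight W)) from rfl, mulVec_add, mulVec_smul,
      schrodinger_mulVec_green h, schrodinger_mulVec_green h]
    simp
    ring

theorem boundaryWeight_oldWeight (hW : ∀ i j, W i j = W j i) :
    boundaryWeight (oldWeight W) (fun i => R (some i)) =
      (fun i => boundaryWeight W R (some i)) + rootWeight W := by
  ext i
  simp [boundaryWeight, Fintype.sum_option, oldWeight, rootWeight, hW (some i) none]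
  ring

/-- Removing the new vertex turns its edges into boundary edges. Compared with `greenField_option`,
the factor a/s is replaced by 1, so the martingale property amounts to a/s having mean one. -/
theorem greenField_oldWeight (hW : ∀ i j, W i j = W j i) :
    greenField (oldWeight W) (fun i => R (some i)) β =
      (green (oldWeight W) β *ᵥ fun i => boundaryWeight W R (some i)) +
        green (oldWeight W) β *ᵥ rootWeight W := by
  rw [greenField, boundaryWeight_oldWeight hW, mulVec_add]

theorem rootDrift_nonneg (hW0 : ∀ i j, 0 ≤ W i j) (hR : ∀ i, 0 ≤ boundaryWeight W R i)
    (h : (schrodinger (oldWeight W) β).PosDef) : boundaryWeight W R none ≤ rootDrift W R β := by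
  refine le_add_of_nonneg_right (Finset.sum_nonneg fun i _ => mul_nonneg (hW0 _ _) ?_)
  exact green_mulVec_nonneg (fun _ _ => hW0 _ _) h (fun i => hR (some i)) i

/-- The density of the inverse of an inverse Gaussian variable, up to a factor two. -/
def rootKernel (a s : ℝ) : ℝ :=
  Real.sqrt (2 / Real.pi) * Real.exp (-(s - a) ^ 2 / (2 * s)) / Real.sqrt s

/-- The potential b enters only through s: -b contributes -s/2, the quadratic term in the boundary
weight contributes -a²/(2s), and together with a cross term a they form -(s - a)²/(2s). The
determinant contributes 1/√s. -/
theorem pinnedDensity_option (hW : ∀ i j, W i j = W j i) (hW0 : W none none = 0)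
    (h : (schrodinger (oldWeight W) β).PosDef) (hs : 0 < schurComplement W β b) :
    pinnedDensity W R (extendPotential β b) =
      pinnedDensity (oldWeight W) (fun i => R (some i)) β *
        rootKernel (rootDrift W R β) (schurComplement W β b) := by
  have hWo : ∀ i j, oldWeight W i j = oldWeight W j i := fun i j => hW _ _
  rw [pinnedDensity_of_posDef _ ((posDef_option_iff hW hW0).2 ⟨h, hs⟩), pinnedDensity_of_posDef _ h,
    det_schrodinger_option hW hW0 h, Real.sqrt_mul h.det_pos.le, Fintype.card_option, pow_succ,
    rootKernel]
  set c := Real.sqrt (2 / Real.pi)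
  set s := schurComplement W β b with hs'
  set a := rootDrift W R β with ha
  have key : -∑ i, extendPotential β b i + ∑ i, R i - (1 / 2) * ∑ i, ∑ j, W i j
        - (1 / 2) * (boundaryWeight W R ⬝ᵥ greenField W R (extendPotential β b)) =
      (-∑ i, β i + ∑ i, R (some i) - (1 / 2) * ∑ i, ∑ j, oldWeight W i j
        - (1 / 2) * (boundaryWeight (oldWeight W) (fun i => R (some i)) ⬝ᵥ
          greenField (oldWeight W) (fun i => R (some i)) β)) + -(s - a) ^ 2 / (2 * s) := by
    rw [dotProduct_option, greenField_option hW hW0 h hs, greenField_oldWeight hW,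
      boundaryWeight_oldWeight hW, ← ha, ← hs']
    simp only [Option.elim]
    set ζ : U → ℝ := fun i => boundaryWeight W R (some i) with hζ
    set w := rootWeight W with hw
    set G := green (oldWeight W) β with hG
    rw [show (fun i => (G *ᵥ ζ + (a / s) • (G *ᵥ w)) i) = G *ᵥ ζ + (a / s) • (G *ᵥ w) from rfl]
    have hsym : ζ ⬝ᵥ (G *ᵥ w) = w ⬝ᵥ (G *ᵥ ζ) := dotProduct_green_comm hWo h _ _
    have hη : boundaryWeight W R none = R none - ∑ i, w i := by
      simp [boundaryWeight, Fintype.sum_option, hW0, hw, rootWeight]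
    have hW2 : ∑ i, ∑ j, W i j = 2 * ∑ i, w i + ∑ i, ∑ j, oldWeight W i j := by
      simp only [Fintype.sum_option, hW0, Finset.sum_add_distrib, hw, rootWeight, oldWeight,
        hW (some _) none]
      ring
    have hb : w ⬝ᵥ (G *ᵥ w) = 2 * b - s := by
      simp only [hs', schurComplement]
      ring
    have ha' : w ⬝ᵥ (G *ᵥ ζ) = a - (R none - ∑ i, w i) := by
      rw [ha, rootDrift, ← hη]
      ring
    rw [hW2]
    simp only [Fintype.sum_option, dotProduct_add, add_dotProduct, dotProduct_smul, hsym, hη,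
      extendPotential, Option.elim, smul_eq_mul, ha', hb]
    field_simp
    ring
  rw [key, Real.exp_add]
  ring

end OptionVertex

/-! ### Integrals of the one-vertex kernel -/

section RootKernel

open Set

theorem hasDerivAt_sub_div_sqrt (a : ℝ) {s : ℝ} (hs : 0 < s) :
    HasDerivAt (fun s => (s - a) / √s) ((1 + a / s) / (2 * √s)) s := by
  have h := ((hasDerivAt_id s).sub_const a).div (Real.hasDerivAt_sqrt hs.ne')
    (Real.sqrt_pos.2 hs).ne'
  refine h.congr_deriv ?_
  have h1 : √s ^ 2 = s := Real.sq_sqrt hs.le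
  have h2 := Real.sqrt_pos.2 hs
  simp only [id]
  rw [h1]
  field_simp
  rw [h1]
  ring

theorem injOn_sub_div_sqrt {a : ℝ} (ha : 0 ≤ a) : InjOn (fun s => (s - a) / √s) (Ioi 0) := by
  intro s hs t ht hst
  have hp := Real.sqrt_pos.2 (mem_Ioi.1 hs)
  have hq := Real.sqrt_pos.2 (mem_Ioi.1 ht)
  have h1 : √s ^ 2 = s := Real.sq_sqrt (mem_Ioi.1 hs).le
  have h2 : √t ^ 2 = t := Real.sq_sqrt (mem_Ioi.1 ht).le
  simp only at hst
  rw [div_eq_div_iff hp.ne' hq.ne'] at hst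
  have h3 : (√s - √t) * (√s * √t + a) = 0 := by
    linear_combination hst + √t * h1 - √s * h2
  have h4 : √s * √t + a ≠ 0 := by positivity
  rcases mul_eq_zero.1 h3 with h | h
  · rw [← h1, ← h2, sub_eq_zero.1 h]
  · exact absurd h h4

theorem image_sub_div_sqrt {a : ℝ} (ha : 0 < a) : (fun s => (s - a) / √s) '' Ioi 0 = univ := by
  refine eq_univ_of_forall fun y => ?_
  -- The positive root of r² - y r - a = 0, the equation for r = √s.
  set r := (y + √(y ^ 2 + 4 * a)) / 2 with hr
  have h1 : √(y ^ 2 + 4 * a) ^ 2 = y ^ 2 + 4 * a := Real.sq_sqrt (by positivity)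
  have hpos : 0 < r := by
    have : |y| < √(y ^ 2 + 4 * a) := Real.lt_sqrt_of_sq_lt (by rw [sq_abs]; linarith)
    have := neg_abs_le y
    linarith
  refine ⟨r ^ 2, pow_pos hpos 2, ?_⟩
  simp only
  rw [Real.sqrt_sq hpos.le, div_eq_iff hpos.ne', hr]
  linear_combination (1 / 4) * h1

theorem sqrt_two_div_pi_mul : √(2 / Real.pi) * √(Real.pi / (1 / 2)) = 2 := by
  rw [← Real.sqrt_mul (by positivity), show 2 / Real.pi * (Real.pi / (1 / 2)) = 2 ^ 2 by
    field_simp, Real.sqrt_sq (by norm_num)]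

theorem integrable_gaussianProfile :
    Integrable fun x : ℝ => √(2 / Real.pi) * Real.exp (-(1 / 2) * x ^ 2) :=
  (integrable_exp_neg_mul_sq (by norm_num)).const_mul _

theorem lintegral_gaussianProfile :
    ∫⁻ x : ℝ, ENNReal.ofReal (√(2 / Real.pi) * Real.exp (-(1 / 2) * x ^ 2)) = 2 := by
  rw [← ofReal_integral_eq_lintegral_ofReal integrable_gaussianProfile
    (ae_of_all _ fun x => by positivity), integral_const_mul, integral_gaussian,
    sqrt_two_div_pi_mul]
  simp

theorem lintegral_Ioi_gaussianProfile :
    ∫⁻ x in Ioi (0 : ℝ), ENNReal.ofReal (√(2 / Real.pi) * Real.exp (-(1 / 2) * x ^ 2)) = 1 := by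
  rw [← ofReal_integral_eq_lintegral_ofReal integrable_gaussianProfile.integrableOn
    (ae_of_all _ fun x => by positivity), integral_const_mul, integral_gaussian_Ioi, mul_div,
    sqrt_two_div_pi_mul]
  simp

theorem rootKernel_nonneg (a s : ℝ) : 0 ≤ rootKernel a s := by
  unfold rootKernel
  positivity

@[fun_prop]
theorem Measurable.rootKernel {α : Type*} [MeasurableSpace α] {f g : α → ℝ} (hf : Measurable f)
    (hg : Measurable g) : Measurable fun x => rootKernel (f x) (g x) := by
  unfold DysonH22.rootKernel
  fun_prop

/-- The substitution x = (s - a)/√s turns the exponent of the kernel into -x²/2, and its derivative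
produces the average of the weights 1 and a/s. -/
theorem setLIntegral_gaussian_comp {a : ℝ} (ha : 0 ≤ a) :
    ∫⁻ x in (fun s => (s - a) / √s) '' Ioi 0,
        ENNReal.ofReal (√(2 / Real.pi) * Real.exp (-(1 / 2) * x ^ 2)) =
      ∫⁻ s in Ioi 0, ENNReal.ofReal ((1 + a / s) / 2 * rootKernel a s) := by
  rw [lintegral_image_eq_lintegral_abs_deriv_mul measurableSet_Ioi
    (fun s hs => (hasDerivAt_sub_div_sqrt a hs).hasDerivWithinAt) (injOn_sub_div_sqrt ha)]
  refine setLIntegral_congr_fun measurableSet_Ioi fun s hs => ?_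
  have hs : 0 < s := hs
  have h2 := Real.sqrt_pos.2 hs
  rw [← ENNReal.ofReal_mul (abs_nonneg _), abs_of_nonneg (by positivity), rootKernel, div_pow,
    Real.sq_sqrt hs.le]
  congr 1
  rw [show -(1 / 2) * ((s - a) ^ 2 / s) = -(s - a) ^ 2 / (2 * s) by field_simp]
  field_simp

/-- The involution s ↦ a²/s preserves the exponent and exchanges the weights 1 and a/s. -/
theorem setLIntegral_rootKernel_inversion {a : ℝ} (ha : 0 < a) :
    ∫⁻ s in Ioi 0, ENNReal.ofReal (rootKernel a s) =
      ∫⁻ s in Ioi 0, ENNReal.ofReal (a / s * rootKernel a s) := by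
  have himg : (fun s => a ^ 2 / s) '' Ioi 0 = Ioi 0 := by
    ext y
    constructor
    · rintro ⟨s, hs, rfl⟩
      exact div_pos (pow_pos ha 2) hs
    · intro hy
      exact ⟨a ^ 2 / y, div_pos (pow_pos ha 2) hy, div_div_cancel₀ (pow_pos ha 2).ne'⟩
  have hinj : InjOn (fun s => a ^ 2 / s) (Ioi 0) := by
    intro s hs t ht hst
    simp only at hst
    rw [div_eq_div_iff (mem_Ioi.1 hs).ne' (mem_Ioi.1 ht).ne'] at hst
    exact (mul_left_cancel₀ (pow_pos ha 2).ne' hst).symm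
  have hder : ∀ s ∈ Ioi (0 : ℝ), HasDerivWithinAt (fun s => a ^ 2 / s) (-(a ^ 2) / s ^ 2) (Ioi 0) s := by
    intro s hs
    have h := ((hasDerivAt_const s (a ^ 2)).div (hasDerivAt_id s) (mem_Ioi.1 hs).ne')
    refine (h.congr_deriv ?_).hasDerivWithinAt
    simp
  conv_lhs => rw [← himg]
  rw [lintegral_image_eq_lintegral_abs_deriv_mul measurableSet_Ioi hder hinj]
  refine setLIntegral_congr_fun measurableSet_Ioi fun s hs => ?_
  have hs : 0 < s := hs
  have h2 := Real.sqrt_pos.2 hs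
  have h3 : √s ^ 2 = s := Real.sq_sqrt hs.le
  rw [← ENNReal.ofReal_mul (abs_nonneg _), neg_div, abs_neg, abs_of_nonneg (by positivity),
    rootKernel, rootKernel, Real.sqrt_div (sq_nonneg a) s, Real.sqrt_sq ha.le]
  congr 1
  rw [show -(a ^ 2 / s - a) ^ 2 / (2 * (a ^ 2 / s)) = -(s - a) ^ 2 / (2 * s) by
    field_simp
    ring]
  field_simp
  rw [h3]

/-- The kernel is twice a probability density. -/
theorem lintegral_rootKernel {a : ℝ} (ha : 0 ≤ a) :
    ∫⁻ s in Ioi 0, ENNReal.ofReal (rootKernel a s) = 2 := by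
  have h := setLIntegral_gaussian_comp ha
  -- For a = 0 the substitution covers only a half-line, of mass one, and the weight a/s vanishes.
  -- For a > 0 it covers the line, of mass two, and the integrals with weights 1 and a/s agree.
  rcases ha.eq_or_lt with rfl | ha
  · have himg : (fun s : ℝ => (s - 0) / √s) '' Ioi 0 = Ioi 0 := by
      ext y
      constructor
      · rintro ⟨s, hs, rfl⟩
        have := Real.sqrt_pos.2 (mem_Ioi.1 hs)
        have hs : 0 < s := hs
        simp only [sub_zero, mem_Ioi]
        positivity
      · intro hy
        have hy : 0 < y := hy
        refine ⟨y ^ 2, pow_pos hy 2, ?_⟩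
        simp only [sub_zero]
        rw [Real.sqrt_sq hy.le, pow_two, mul_div_assoc, div_self hy.ne', mul_one]
    rw [himg, lintegral_Ioi_gaussianProfile] at h
    have h2 : ∀ s : ℝ, ENNReal.ofReal ((1 + 0 / s) / 2 * rootKernel 0 s) =
        2⁻¹ * ENNReal.ofReal (rootKernel 0 s) := by
      intro s
      rw [zero_div, add_zero, ENNReal.ofReal_mul (by norm_num), one_div,
        ENNReal.ofReal_inv_of_pos (by norm_num)]
      simp
    simp_rw [h2] at h
    rw [lintegral_const_mul _ (by fun_prop)] at h
    have h3 := congrArg (fun x => 2 * x) h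
    simp only [← mul_assoc, mul_one] at h3
    rw [ENNReal.mul_inv_cancel (by norm_num) (by norm_num), one_mul] at h3
    exact h3.symm
  · rw [image_sub_div_sqrt ha, Measure.restrict_univ, lintegral_gaussianProfile] at h
    have h2 : ∀ s ∈ Ioi (0 : ℝ), ENNReal.ofReal ((1 + a / s) / 2 * rootKernel a s) =
        2⁻¹ * (ENNReal.ofReal (rootKernel a s) + ENNReal.ofReal (a / s * rootKernel a s)) := by
      intro s hs
      have hs : 0 < s := hs
      have := rootKernel_nonneg a s
      rw [← ENNReal.ofReal_add (by positivity) (by positivity),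
        show (2⁻¹ : ENNReal) = ENNReal.ofReal 2⁻¹ by
          rw [ENNReal.ofReal_inv_of_pos (by norm_num)]; simp,
        ← ENNReal.ofReal_mul (by norm_num)]
      congr 1
      ring
    rw [setLIntegral_congr_fun measurableSet_Ioi h2, lintegral_const_mul _ (by fun_prop),
      lintegral_add_left (by fun_prop), ← setLIntegral_rootKernel_inversion ha, ← two_mul,
      ← mul_assoc, ENNReal.inv_mul_cancel (by norm_num) (by norm_num), one_mul] at h
    exact h.symm

theorem lintegral_div_mul_rootKernel {a : ℝ} (ha : 0 < a) :
    ∫⁻ s in Ioi 0, ENNReal.ofReal (a / s * rootKernel a s) = 2 := by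
  rw [← setLIntegral_rootKernel_inversion ha, lintegral_rootKernel ha.le]

/-- Change of variables from the potential at a vertex to the Schur complement. -/
theorem setLIntegral_comp_two_mul_sub (c : ℝ) (g : ℝ → ENNReal) :
    2 * ∫⁻ b in {b | 0 < 2 * b - c}, g (2 * b - c) = ∫⁻ s in Ioi 0, g s := by
  have hder : ∀ b ∈ {b : ℝ | 0 < 2 * b - c},
      HasDerivWithinAt (fun b => 2 * b - c) 2 {b : ℝ | 0 < 2 * b - c} b := fun b _ => by
    simpa using (((hasDerivAt_id b).const_mul 2).sub_const c).hasDerivWithinAt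
  have himg : (fun b : ℝ => 2 * b - c) '' {b | 0 < 2 * b - c} = Ioi 0 := by
    ext y
    constructor
    · rintro ⟨b, hb, rfl⟩
      exact hb
    · intro hy
      have h : 2 * ((y + c) / 2) - c = y := by ring
      exact ⟨(y + c) / 2, show 0 < 2 * ((y + c) / 2) - c from h.symm ▸ hy, h⟩
  have hm : MeasurableSet {b : ℝ | 0 < 2 * b - c} :=
    measurableSet_lt measurable_const (by fun_prop)
  rw [← himg, lintegral_image_eq_lintegral_abs_deriv_mul hm hder (fun x _ y _ h => by
    linarith [show 2 * x - c = 2 * y - c from h])]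
  rw [lintegral_const_mul' _ _ (by simp)]
  simp

end RootKernel

/-! ### Measurability and semicontinuity of the density -/

section Regularity

open Matrix

variable {V : Type*} [Fintype V] [DecidableEq V]

/-- Compactness of the sphere makes positive definiteness an open condition among Hermitian
matrices. This gives measurability in β and stability under small changes of the weights. -/
theorem posDef_iff_forall_sphere {M : Matrix V V ℝ} (hM : M.IsHermitian) :
    M.PosDef ↔ ∀ x ∈ Metric.sphere (0 : V → ℝ) 1, 0 < x ⬝ᵥ (M *ᵥ x) := by
  constructor
  · intro h x hx
    have hne : x ≠ 0 := by
      rintro rfl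
      simp at hx
    simpa using h.dotProduct_mulVec_pos hne
  · intro h
    refine .of_dotProduct_mulVec_pos hM fun x hx => ?_
    have hn : 0 < ‖x‖ := norm_pos_iff.2 hx
    have h1 := h (‖x‖⁻¹ • x) (by simp [norm_smul, hn.ne'])
    rw [mulVec_smul, smul_dotProduct, dotProduct_smul, smul_eq_mul, smul_eq_mul] at h1
    rw [star_trivial]
    have h2 : 0 < ‖x‖⁻¹ := inv_pos.2 hn
    exact (mul_pos_iff_of_pos_left h2).1 ((mul_pos_iff_of_pos_left h2).1 h1)

theorem isOpen_forall_sphere_pos :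
    IsOpen {M : Matrix V V ℝ | ∀ x ∈ Metric.sphere (0 : V → ℝ) 1, 0 < x ⬝ᵥ (M *ᵥ x)} := by
  rw [isOpen_iff_eventually]
  intro M hM
  refine (isCompact_sphere (0 : V → ℝ) 1).eventually_forall_of_forall_eventually fun x hx => ?_
  have hc : Continuous fun p : Matrix V V ℝ × (V → ℝ) => p.2 ⬝ᵥ (p.1 *ᵥ p.2) := by fun_prop
  exact hc.continuousAt.eventually (lt_mem_nhds (hM x hx))

@[fun_prop]
theorem Continuous.schrodinger {X : Type*} [TopologicalSpace X] {W : X → V → V → ℝ}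
    {β : X → V → ℝ} (hW : Continuous W) (hβ : Continuous β) :
    Continuous fun x => schrodinger (W x) (β x) := by
  unfold DysonH22.schrodinger
  refine .sub (.matrix_diagonal (by fun_prop)) (continuous_matrix fun i j => ?_)
  simp only [of_apply]
  fun_prop

theorem measurableSet_posDef {W : V → V → ℝ} (hW : ∀ i j, W i j = W j i) :
    MeasurableSet {β : V → ℝ | (schrodinger W β).PosDef} := by
  have : {β : V → ℝ | (schrodinger W β).PosDef} = (fun β => schrodinger W β) ⁻¹'
      {M | ∀ x ∈ Metric.sphere (0 : V → ℝ) 1, 0 < x ⬝ᵥ (M *ᵥ x)} :=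
    Set.ext fun β => posDef_iff_forall_sphere (schrodinger_isHermitian hW β)
  rw [this]
  exact (isOpen_forall_sphere_pos.preimage (by fun_prop)).measurableSet

theorem measurable_greenField (W : V → V → ℝ) (R : V → ℝ) : Measurable (greenField W R) := by
  refine measurable_pi_lambda _ fun i => ?_
  simp only [greenField, green, mulVec, dotProduct, inv_def, Ring.inverse_eq_inv', Matrix.smul_apply,
    smul_eq_mul]
  have h1 : Measurable fun β => (schrodinger W β).det :=
    (Continuous.matrix_det (by fun_prop)).measurable
  have h2 : ∀ j, Measurable fun β => (schrodinger W β).adjugate i j := fun j =>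
    (Continuous.matrix_elem (Continuous.matrix_adjugate (by fun_prop)) i j).measurable
  exact Finset.measurable_sum _ fun j _ => ((h1.inv.mul (h2 j)).mul_const _)

theorem measurable_greenField_apply (W : V → V → ℝ) (R : V → ℝ) (i : V) :
    Measurable fun β => greenField W R β i :=
  (measurable_pi_apply i).comp (measurable_greenField W R)

theorem measurable_pinnedDensity {W : V → V → ℝ} (hW : ∀ i j, W i j = W j i) (R : V → ℝ) :
    Measurable (pinnedDensity W R) := by
  refine Measurable.ite (measurableSet_posDef hW) ?_ measurable_const
  have h1 : Measurable fun β => (schrodinger W β).det :=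
    (Continuous.matrix_det (by fun_prop)).measurable
  have h2 : Measurable fun β => boundaryWeight W R ⬝ᵥ greenField W R β :=
    Finset.measurable_sum _ fun i _ =>
      (measurable_greenField_apply W R i).const_mul _
  fun_prop

theorem pinnedDensity_nonneg (W : V → V → ℝ) (R β : V → ℝ) : 0 ≤ pinnedDensity W R β := by
  unfold pinnedDensity
  split_ifs
  · positivity
  · exact le_rfl

/-- The density is lower semicontinuous in the weights. -/
theorem pinnedDensity_le_liminf {W : V → V → ℝ} {R : V → ℝ}
    {Wn : ℕ → V → V → ℝ} (hWn : ∀ n i j, Wn n i j = Wn n j i)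
    (hlim : Tendsto Wn atTop (𝓝 W)) (β : V → ℝ) :
    ENNReal.ofReal (pinnedDensity W R β) ≤
      liminf (fun n => ENNReal.ofReal (pinnedDensity (Wn n) R β)) atTop := by
  -- Where the limit matrix is positive definite the densities converge; elsewhere the left side is
  -- zero.
  by_cases h : (schrodinger W β).PosDef
  · have hS : Tendsto (fun n => schrodinger (Wn n) β) atTop (𝓝 (schrodinger W β)) :=
      ((Continuous.schrodinger continuous_id continuous_const).tendsto W).comp hlim
    have hev : ∀ᶠ n in atTop, (schrodinger (Wn n) β).PosDef := by
      filter_upwards [hS.eventually (isOpen_forall_sphere_pos.eventually_mem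
        ((posDef_iff_forall_sphere h.1).1 h))] with n hn
      exact (posDef_iff_forall_sphere (schrodinger_isHermitian (hWn n) β)).2 hn
    have hdet : Tendsto (fun n => (schrodinger (Wn n) β).det) atTop
        (𝓝 (schrodinger W β).det) := ((continuous_id.matrix_det).tendsto _).comp hS
    have hgreen : Tendsto (fun n => green (Wn n) β) atTop (𝓝 (green W β)) := by
      simp only [green, inv_def, Ring.inverse_eq_inv']
      exact (hdet.inv₀ h.det_pos.ne').smul (((continuous_id.matrix_adjugate).tendsto _).comp hS)
    have hWij : ∀ i j, Tendsto (fun n => Wn n i j) atTop (𝓝 (W i j)) := fun i j =>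
      (tendsto_pi_nhds.1 ((tendsto_pi_nhds.1 hlim) i)) j
    have hbd : Tendsto (fun n => boundaryWeight (Wn n) R) atTop (𝓝 (boundaryWeight W R)) :=
      tendsto_pi_nhds.2 fun i => tendsto_const_nhds.sub (tendsto_finsetSum _ fun j _ => hWij i j)
    have hfield : Tendsto (fun n => greenField (Wn n) R β) atTop (𝓝 (greenField W R β)) := by
      have hc : Continuous fun p : Matrix V V ℝ × (V → ℝ) => p.1 *ᵥ p.2 := by fun_prop
      exact (hc.tendsto _).comp (hgreen.prodMk_nhds hbd)
    have hdot : Tendsto (fun n => boundaryWeight (Wn n) R ⬝ᵥ greenField (Wn n) R β) atTop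
        (𝓝 (boundaryWeight W R ⬝ᵥ greenField W R β)) := by
      have hc : Continuous fun p : (V → ℝ) × (V → ℝ) => p.1 ⬝ᵥ p.2 := by fun_prop
      exact (hc.tendsto _).comp (hbd.prodMk_nhds hfield)
    have hsum : Tendsto (fun n => ∑ i, ∑ j, Wn n i j) atTop (𝓝 (∑ i, ∑ j, W i j)) :=
      tendsto_finsetSum _ fun i _ => tendsto_finsetSum _ fun j _ => hWij i j
    have hmain : Tendsto (fun n => pinnedDensity (Wn n) R β) atTop (𝓝 (pinnedDensity W R β)) := by
      rw [pinnedDensity_of_posDef R h]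
      refine Tendsto.congr' (hev.mono fun n hn => (pinnedDensity_of_posDef R hn).symm) ?_
      refine Tendsto.div (tendsto_const_nhds.mul ((Real.continuous_exp.tendsto _).comp ?_))
        ((Real.continuous_sqrt.tendsto _).comp hdet) (Real.sqrt_pos.2 h.det_pos).ne'
      exact (tendsto_const_nhds.sub (hsum.const_mul _)).sub (hdot.const_mul _)
    exact (ENNReal.tendsto_ofReal hmain).liminf_eq.ge
  · rw [pinnedDensity_of_not_posDef R h]
    simp

theorem lintegral_pinnedMeasure {W : V → V → ℝ} (hW : ∀ i j, W i j = W j i) (R : V → ℝ)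
    {f : (V → ℝ) → ENNReal} (hf : Measurable f) :
    ∫⁻ x, f x ∂pinnedMeasure W R = ∫⁻ x, ENNReal.ofReal (pinnedDensity W R x) * f x := by
  rw [pinnedMeasure, lintegral_withDensity_eq_lintegral_mul _
    (measurable_pinnedDensity hW R).ennreal_ofReal hf]
  rfl

theorem ae_posDef_pinnedMeasure {W : V → V → ℝ} (hW : ∀ i j, W i j = W j i) (R : V → ℝ) :
    ∀ᵐ β ∂pinnedMeasure W R, (schrodinger W β).PosDef := by
  rw [pinnedMeasure, ae_withDensity_iff (measurable_pinnedDensity hW R).ennreal_ofReal]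
  refine ae_of_all _ fun β hβ => ?_
  by_contra h
  exact hβ (by rw [pinnedDensity_of_not_posDef R h, ENNReal.ofReal_zero])

end Regularity

/-! ### Marginals -/

section Marginals

open Matrix

theorem lintegral_option {U : Type*} [Fintype U] {f : (Option U → ℝ) → ENNReal}
    (hf : Measurable f) :
    ∫⁻ x, f x = ∫⁻ β : U → ℝ, ∫⁻ b : ℝ, f (extendPotential β b) := by
  have h := Measure.pi_map_piOptionEquivProd (fun _ : Option U => (volume : Measure ℝ))
  rw [volume_pi, ← h, lintegral_map_equiv, lintegral_prod _ (by fun_prop)]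
  have : ∀ (β : U → ℝ) (b : ℝ),
      (MeasurableEquiv.piOptionEquivProd fun _ : Option U => ℝ).symm (β, b) =
        extendPotential β b := by
    intro β b
    rw [MeasurableEquiv.symm_apply_eq]
    rfl
  simp_rw [this]
  rfl

variable {U : Type*} [Fintype U] [DecidableEq U] {W : Option U → Option U → ℝ} {R : Option U → ℝ}
  {β : U → ℝ}

/-- The factor two is the Jacobian of b ↦ s. The integrands `K` and `k` need to correspond only for
s > 0, since the density vanishes otherwise. -/
theorem lintegral_root (hW : ∀ i j, W i j = W j i) (hd : W none none = 0)
    (h : (schrodinger (oldWeight W) β).PosDef) {K k : ℝ → ENNReal}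
    (hK : ∀ b, 0 < schurComplement W β b → K b = k (schurComplement W β b)) :
    2 * ∫⁻ b, ENNReal.ofReal (pinnedDensity W R (extendPotential β b)) * K b =
      ENNReal.ofReal (pinnedDensity (oldWeight W) (fun i => R (some i)) β) *
        ∫⁻ s in Set.Ioi 0, k s * ENNReal.ofReal (rootKernel (rootDrift W R β) s) := by
  rw [← setLIntegral_comp_two_mul_sub
    (rootWeight W ⬝ᵥ (green (oldWeight W) β *ᵥ rootWeight W)), mul_left_comm,
    ← lintegral_const_mul' _ _ ENNReal.ofReal_ne_top,
    ← lintegral_indicator (measurableSet_lt measurable_const (by fun_prop))]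
  congr 1
  refine lintegral_congr fun b => ?_
  by_cases hs : 0 < schurComplement W β b
  · rw [Set.indicator_of_mem (by exact hs), pinnedDensity_option hW hd h hs, hK b hs,
      ENNReal.ofReal_mul (pinnedDensity_nonneg _ _ _), mul_assoc, mul_comm (k _)]
    rfl
  · rw [Set.indicator_of_notMem (by exact hs), pinnedDensity_of_not_posDef, ENNReal.ofReal_zero,
      zero_mul]
    exact fun h' => hs ((posDef_option_iff hW hd).1 h').2

theorem pinnedDensity_extendPotential_of_not_posDef (h : ¬ (schrodinger (oldWeight W) β).PosDef)
    (b : ℝ) : pinnedDensity W R (extendPotential β b) = 0 := by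
  refine pinnedDensity_of_not_posDef _ fun h' => h ?_
  rw [← schrodinger_submatrix_some (b := b)]
  exact h'.submatrix (Option.some_injective _)

theorem eq_of_two_mul_eq {a b : ENNReal} (h : 2 * a = b * 2) : a = b := by
  rw [mul_comm b] at h
  exact (ENNReal.mul_right_inj (by norm_num) (by norm_num)).1 h

theorem lintegral_pinnedDensity_option (hW : ∀ i j, W i j = W j i) (hd : W none none = 0)
    (hW0 : ∀ i j, 0 ≤ W i j) (hR : ∀ i, 0 ≤ boundaryWeight W R i) (β : U → ℝ) :
    ∫⁻ b, ENNReal.ofReal (pinnedDensity W R (extendPotential β b)) =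
      ENNReal.ofReal (pinnedDensity (oldWeight W) (fun i => R (some i)) β) := by
  by_cases h : (schrodinger (oldWeight W) β).PosDef
  · have := lintegral_root (R := R) hW hd h (K := 1) (k := 1) fun _ _ => rfl
    simp only [Pi.one_apply, mul_one, one_mul] at this
    rw [lintegral_rootKernel ((hR none).trans (rootDrift_nonneg hW0 hR h))] at this
    exact eq_of_two_mul_eq this
  · simp [pinnedDensity_extendPotential_of_not_posDef h, pinnedDensity_of_not_posDef _ h]

/-- The value at the new vertex is a/s. Strict positivity of the boundary weight ensures a > 0; for
a = 0 the integral of a/s would vanish. -/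
theorem lintegral_greenField_none (hW : ∀ i j, W i j = W j i) (hd : W none none = 0)
    (hW0 : ∀ i j, 0 ≤ W i j) (hR : ∀ i, 0 < boundaryWeight W R i) (β : U → ℝ) :
    ∫⁻ b, ENNReal.ofReal (pinnedDensity W R (extendPotential β b)) *
        ENNReal.ofReal (greenField W R (extendPotential β b) none) =
      ENNReal.ofReal (pinnedDensity (oldWeight W) (fun i => R (some i)) β) := by
  by_cases h : (schrodinger (oldWeight W) β).PosDef
  · have ha := (hR none).trans_le (rootDrift_nonneg hW0 (fun i => (hR i).le) h)
    have := lintegral_root (R := R) hW hd h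
      (K := fun b => ENNReal.ofReal (greenField W R (extendPotential β b) none))
      (k := fun s => ENNReal.ofReal (rootDrift W R β / s))
      fun b hs => by rw [greenField_option hW hd h hs]; rfl
    rw [setLIntegral_congr_fun (g := fun s => ENNReal.ofReal
        (rootDrift W R β / s * rootKernel (rootDrift W R β) s)) measurableSet_Ioi
        (fun s hs => (ENNReal.ofReal_mul (div_nonneg ha.le (le_of_lt hs))).symm),
      lintegral_div_mul_rootKernel ha] at this
    exact eq_of_two_mul_eq this
  · simp [pinnedDensity_extendPotential_of_not_posDef h, pinnedDensity_of_not_posDef _ h]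

/-- Given the old potential, the value at i is p + (a/s) q with p and q fixed; as a/s has mean one,
the average is p + q, the value without the new vertex. -/
theorem lintegral_greenField_some (hW : ∀ i j, W i j = W j i) (hd : W none none = 0)
    (hW0 : ∀ i j, 0 ≤ W i j) (hR : ∀ i, 0 < boundaryWeight W R i) (β : U → ℝ) (i : U) :
    ∫⁻ b, ENNReal.ofReal (pinnedDensity W R (extendPotential β b)) *
        ENNReal.ofReal (greenField W R (extendPotential β b) (some i)) =
      ENNReal.ofReal (pinnedDensity (oldWeight W) (fun i => R (some i)) β) *
        ENNReal.ofReal (greenField (oldWeight W) (fun i => R (some i)) β i) := by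
  by_cases h : (schrodinger (oldWeight W) β).PosDef
  · have ha := (hR none).trans_le (rootDrift_nonneg hW0 (fun i => (hR i).le) h)
    set a := rootDrift W R β
    set p := (green (oldWeight W) β *ᵥ fun i => boundaryWeight W R (some i)) i with hp
    set q := (green (oldWeight W) β *ᵥ rootWeight W) i with hq
    have hp0 : 0 ≤ p := green_mulVec_nonneg (fun _ _ => hW0 _ _) h (fun i => (hR (some i)).le) i
    have hq0 : 0 ≤ q := green_mulVec_nonneg (fun _ _ => hW0 _ _) h (fun i => hW0 _ _) i
    have := lintegral_root (R := R) hW hd h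
      (K := fun b => ENNReal.ofReal (greenField W R (extendPotential β b) (some i)))
      (k := fun s => ENNReal.ofReal (p + a / s * q))
      fun b hs => by rw [greenField_option hW hd h hs]; rfl
    rw [setLIntegral_congr_fun (g := fun s => ENNReal.ofReal p * ENNReal.ofReal (rootKernel a s) +
        ENNReal.ofReal q * ENNReal.ofReal (a / s * rootKernel a s)) measurableSet_Ioi
        (fun s hs => ?_), lintegral_add_left (by fun_prop), lintegral_const_mul _ (by fun_prop),
      lintegral_const_mul _ (by fun_prop), lintegral_div_mul_rootKernel ha,
      lintegral_rootKernel ha.le, ← add_mul, ← ENNReal.ofReal_add hp0 hq0, ← mul_assoc] at this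
    · rw [eq_of_two_mul_eq this, greenField_oldWeight hW]
      rfl
    · have hs : 0 < s := hs
      have hk := rootKernel_nonneg a s
      simp only
      rw [← ENNReal.ofReal_mul (by positivity), ← ENNReal.ofReal_mul hp0,
        ← ENNReal.ofReal_mul hq0, ← ENNReal.ofReal_add (by positivity) (by positivity)]
      congr 1
      ring
  · simp [pinnedDensity_extendPotential_of_not_posDef h, pinnedDensity_of_not_posDef _ h]

end Marginals

/-! ### Restriction along embeddings, and continuity of the laws in the weights. -/

section Embeddings

open Matrix

universe u

/-- Symmetric nonnegative weights that vanish on the diagonal. -/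
structure IsWeight {V : Type*} (W : V → V → ℝ) : Prop where
  symm : ∀ i j, W i j = W j i
  diag : ∀ i, W i i = 0
  nonneg : ∀ i j, 0 ≤ W i j

theorem IsWeight.comp {U V : Type*} {W : V → V → ℝ} (h : IsWeight W) (e : U → V) :
    IsWeight fun i j => W (e i) (e j) :=
  ⟨fun _ _ => h.symm _ _, fun _ => h.diag _, fun _ _ => h.nonneg _ _⟩

/-- Edges to removed vertices become boundary edges, so the positivity hypotheses survive
restriction. -/
theorem boundaryWeight_comp_le {U V : Type*} [Fintype U] [Fintype V] {W : V → V → ℝ}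
    (h : IsWeight W) (R : V → ℝ) (e : U ↪ V) (i : U) :
    boundaryWeight W R (e i) ≤
      boundaryWeight (fun i j => W (e i) (e j)) (fun i => R (e i)) i := by
  classical
  refine sub_le_sub_left ?_ _
  rw [← Finset.sum_map Finset.univ e (fun j => W (e i) j)]
  exact Finset.sum_le_univ_sum_of_nonneg fun j => h.nonneg _ _

theorem measurable_extendPotential {U : Type*} (β : U → ℝ) : Measurable (extendPotential β) :=
  measurable_pi_lambda _ fun i => by cases i <;> simp [extendPotential, measurable_id']

/-- Every embedding of a finite type arises from an equivalence by removing vertices one by one. -/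
theorem embedding_induction {V : Type u} [Fintype V]
    {P : ∀ {U : Type u} [Fintype U] [DecidableEq U], (U ↪ V) → Prop}
    (equiv : ∀ {U : Type u} [Fintype U] [DecidableEq U] (e : U ≃ V), P e.toEmbedding)
    (step : ∀ {U : Type u} [Fintype U] [DecidableEq U] (e : Option U ↪ V), P e →
      P (Function.Embedding.some.trans e))
    {U : Type u} [Fintype U] [DecidableEq U] (e : U ↪ V) : P e := by
  induction hn : Fintype.card V - Fintype.card U generalizing U with
  | zero =>
    have hle := Fintype.card_le_of_embedding e
    have hb : Function.Bijective e :=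
      (Fintype.bijective_iff_injective_and_card e).2 ⟨e.injective, by omega⟩
    have := equiv (Equiv.ofBijective e hb)
    convert this
    ext
    rfl
  | succ n ih =>
    have hns : ¬ Function.Surjective e := by
      intro hs
      have := Fintype.card_le_of_surjective e hs
      omega
    obtain ⟨v, hv⟩ := not_forall.1 hns
    have hv : v ∉ Set.range e := hv
    have := step (e.optionElim v hv) (ih _ (by rw [Fintype.card_option]; omega))
    convert this
    ext
    rfl

variable {V : Type u} [Fintype V] [DecidableEq V] {W : V → V → ℝ} {R : V → ℝ}

section Equiv

variable {U : Type*} [Fintype U] [DecidableEq U]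

theorem schrodinger_comp_equiv (W : V → V → ℝ) (β : V → ℝ) (e : U ≃ V) :
    schrodinger (fun i j => W (e i) (e j)) (fun i => β (e i)) =
      (schrodinger W β).submatrix e e := by
  ext i j
  simp [schrodinger, Matrix.diagonal_apply]

theorem boundaryWeight_comp_equiv (W : V → V → ℝ) (R : V → ℝ) (e : U ≃ V) (i : U) :
    boundaryWeight (fun i j => W (e i) (e j)) (fun i => R (e i)) i = boundaryWeight W R (e i) := by
  rw [boundaryWeight, boundaryWeight, e.sum_comp (fun j => W (e i) j)]

theorem greenField_comp_equiv (W : V → V → ℝ) (R β : V → ℝ) (e : U ≃ V) (i : U) :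
    greenField (fun i j => W (e i) (e j)) (fun i => R (e i)) (fun i => β (e i)) i =
      greenField W R β (e i) := by
  simp only [greenField, green, schrodinger_comp_equiv, inv_submatrix_equiv, mulVec, dotProduct,
    boundaryWeight_comp_equiv, submatrix_apply]
  exact e.sum_comp fun j => (schrodinger W β)⁻¹ (e i) j * boundaryWeight W R j

theorem posDef_comp_equiv (W : V → V → ℝ) (β : V → ℝ) (e : U ≃ V) :
    (schrodinger (fun i j => W (e i) (e j)) (fun i => β (e i))).PosDef ↔
      (schrodinger W β).PosDef := by
  rw [schrodinger_comp_equiv]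
  refine ⟨fun h => ?_, fun h => h.submatrix e.injective⟩
  simpa using h.submatrix e.symm.injective

theorem pinnedDensity_comp_equiv (W : V → V → ℝ) (R β : V → ℝ) (e : U ≃ V) :
    pinnedDensity (fun i j => W (e i) (e j)) (fun i => R (e i)) (fun i => β (e i)) =
      pinnedDensity W R β := by
  by_cases h : (schrodinger W β).PosDef
  · rw [pinnedDensity_of_posDef _ h, pinnedDensity_of_posDef _ ((posDef_comp_equiv W β e).2 h),
      Fintype.card_congr e, schrodinger_comp_equiv, det_submatrix_equiv_self, e.sum_comp β,
      e.sum_comp R, e.sum_comp fun i => ∑ j, W i (e j)]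
    simp only [dotProduct, greenField_comp_equiv, boundaryWeight_comp_equiv]
    simp only [fun i => e.sum_comp fun j => W i j]
    rw [e.sum_comp fun i => boundaryWeight W R i * greenField W R β i]
  · rw [pinnedDensity_of_not_posDef _ h,
      pinnedDensity_of_not_posDef _ (mt (posDef_comp_equiv W β e).1 h)]

theorem lintegral_comp_equiv (e : U ≃ V) (f : (U → ℝ) → ENNReal) :
    ∫⁻ x : V → ℝ, f (fun i => x (e i)) = ∫⁻ y, f y := by
  have h := (volume_measurePreserving_piCongrLeft (fun _ : V => ℝ) e).symm
  rw [← h.lintegral_comp_emb (MeasurableEquiv.measurableEmbedding _)]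
  rfl

end Equiv

variable {U : Type u} [Fintype U] [DecidableEq U]

theorem lintegral_pinnedDensity_comp (hW : IsWeight W) (hR : ∀ i, 0 ≤ boundaryWeight W R i)
    (e : U ↪ V) {g : (U → ℝ) → ENNReal} (hg : Measurable g) :
    ∫⁻ x, ENNReal.ofReal (pinnedDensity W R x) * g (fun i => x (e i)) =
      ∫⁻ y, ENNReal.ofReal
        (pinnedDensity (fun i j => W (e i) (e j)) (fun i => R (e i)) y) * g y := by
  revert g
  refine embedding_induction (P := fun {U} _ _ e => ∀ {g : (U → ℝ) → ENNReal}, Measurable g →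
    ∫⁻ x, ENNReal.ofReal (pinnedDensity W R x) * g (fun i => x (e i)) =
      ∫⁻ y, ENNReal.ofReal
        (pinnedDensity (fun i j => W (e i) (e j)) (fun i => R (e i)) y) * g y) ?_ ?_ e
  · intro U _ _ e g hg
    rw [← lintegral_comp_equiv e]
    simp only [Equiv.coe_toEmbedding, pinnedDensity_comp_equiv]
  · intro U _ _ e ih g hg
    have hWe := hW.comp e
    have hm := measurable_pinnedDensity hWe.symm fun i => R (e i)
    refine (ih (g := fun x => g fun i => x (some i)) (by fun_prop)).trans ?_
    rw [lintegral_option (by fun_prop)]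
    refine lintegral_congr fun β => ?_
    have hmb : Measurable fun b => ENNReal.ofReal (pinnedDensity (fun i j => W (e i) (e j))
        (fun i => R (e i)) (extendPotential β b)) :=
      hm.ennreal_ofReal.comp (measurable_extendPotential β)
    change ∫⁻ b, _ * g β = _
    rw [lintegral_mul_const _ hmb,
      lintegral_pinnedDensity_option hWe.symm (hWe.diag _) hWe.nonneg
        fun i => (hR _).trans (boundaryWeight_comp_le hW R e i)]
    rfl

/-- The martingale property in finite volume: `g` is an arbitrary test function of the potential on
the smaller set. -/
theorem lintegral_greenField_comp (hW : IsWeight W) (hR : ∀ i, 0 < boundaryWeight W R i)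
    (e : U ↪ V) (i : U) {g : (U → ℝ) → ENNReal} (hg : Measurable g) :
    ∫⁻ x, ENNReal.ofReal (pinnedDensity W R x) *
        (ENNReal.ofReal (greenField W R x (e i)) * g (fun i => x (e i))) =
      ∫⁻ y, ENNReal.ofReal (pinnedDensity (fun i j => W (e i) (e j)) (fun i => R (e i)) y) *
        (ENNReal.ofReal (greenField (fun i j => W (e i) (e j)) (fun i => R (e i)) y i) * g y) := by
  revert i g
  refine embedding_induction (P := fun {U} _ _ e => ∀ (i : U) {g : (U → ℝ) → ENNReal},
    Measurable g → ∫⁻ x, ENNReal.ofReal (pinnedDensity W R x) *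
        (ENNReal.ofReal (greenField W R x (e i)) * g (fun i => x (e i))) =
      ∫⁻ y, ENNReal.ofReal (pinnedDensity (fun i j => W (e i) (e j)) (fun i => R (e i)) y) *
        (ENNReal.ofReal (greenField (fun i j => W (e i) (e j)) (fun i => R (e i)) y i) * g y))
    ?_ ?_ e
  · intro U _ _ e i g hg
    rw [← lintegral_comp_equiv e]
    simp only [Equiv.coe_toEmbedding, pinnedDensity_comp_equiv, greenField_comp_equiv]
  · intro U _ _ e ih i g hg
    have hWe := hW.comp e
    have hm := measurable_pinnedDensity hWe.symm fun i => R (e i)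
    have hm' := measurable_greenField_apply (fun i j => W (e i) (e j)) (fun i => R (e i)) (some i)
    refine (ih (some i) (g := fun x => g fun i => x (some i)) (by fun_prop)).trans ?_
    simp only [← mul_assoc]
    rw [lintegral_option (by
      exact (hm.ennreal_ofReal.mul hm'.ennreal_ofReal).mul (hg.comp (by fun_prop)))]
    refine lintegral_congr fun β => ?_
    have hmb : Measurable fun b => ENNReal.ofReal (pinnedDensity (fun i j => W (e i) (e j))
          (fun i => R (e i)) (extendPotential β b)) *
        ENNReal.ofReal (greenField (fun i j => W (e i) (e j)) (fun i => R (e i))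
          (extendPotential β b) (some i)) :=
      (hm.ennreal_ofReal.mul hm'.ennreal_ofReal).comp (measurable_extendPotential β)
    change ∫⁻ b, _ * g β = _
    rw [lintegral_mul_const _ hmb,
      lintegral_greenField_some hWe.symm (hWe.diag _) hWe.nonneg
        fun i => (hR _).trans_le (boundaryWeight_comp_le hW R e i)]
    rfl

theorem map_pinnedMeasure (hW : IsWeight W) (hR : ∀ i, 0 ≤ boundaryWeight W R i) (e : U ↪ V) :
    (pinnedMeasure W R).map (fun x i => x (e i)) =
      pinnedMeasure (fun i j => W (e i) (e j)) fun i => R (e i) := by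
  refine Measure.ext_of_lintegral _ fun g hg => ?_
  rw [lintegral_map hg (by fun_prop), lintegral_pinnedMeasure hW.symm _ (by fun_prop),
    lintegral_pinnedMeasure (hW.comp e).symm _ hg, lintegral_pinnedDensity_comp hW hR e hg]

theorem lintegral_pinnedDensity_of_isEmpty {V : Type*} [Fintype V] [DecidableEq V] [IsEmpty V]
    (W : V → V → ℝ) (R : V → ℝ) : ∫⁻ x, ENNReal.ofReal (pinnedDensity W R x) = 1 := by
  have : ∀ x, pinnedDensity W R x = 1 := fun x => by
    rw [pinnedDensity_of_posDef]
    · simp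
    · exact .of_dotProduct_mulVec_pos (Subsingleton.elim _ _) fun x hx =>
        absurd (Subsingleton.elim _ _) hx
  simp [this, volume_pi]

theorem isProbabilityMeasure_pinnedMeasure (hW : IsWeight W)
    (hR : ∀ i, 0 ≤ boundaryWeight W R i) : IsProbabilityMeasure (pinnedMeasure W R) := by
  constructor
  -- All vertices are integrated out, down to the empty graph.
  have h := lintegral_pinnedDensity_comp hW hR
    (⟨PEmpty.elim, fun i => i.elim⟩ : PEmpty.{u + 1} ↪ V) (g := 1) measurable_const
  simp only [Pi.one_apply, mul_one] at h
  rw [pinnedMeasure, withDensity_apply _ .univ, Measure.restrict_univ, h,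
    lintegral_pinnedDensity_of_isEmpty]

theorem lintegral_greenField (hW : IsWeight W) (hR : ∀ i, 0 < boundaryWeight W R i) (v : V) :
    ∫⁻ x, ENNReal.ofReal (greenField W R x v) ∂pinnedMeasure W R = 1 := by
  rw [lintegral_pinnedMeasure hW.symm _
    (measurable_greenField_apply W R v).ennreal_ofReal]
  -- The martingale property reduces the claim to the single vertex v.
  set e : Option PEmpty.{u + 1} ↪ V := ⟨fun _ => v, fun i j _ => by
    rcases i with _ | ⟨⟨⟩⟩; rcases j with _ | ⟨⟨⟩⟩; rfl⟩
  have h := lintegral_greenField_comp hW hR e none (g := 1) measurable_const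
  simp only [Pi.one_apply, mul_one] at h
  have hWe := hW.comp e
  have hm := measurable_pinnedDensity hWe.symm fun i => R (e i)
  have hm' := measurable_greenField_apply (fun i j => W (e i) (e j)) (fun i => R (e i)) none
  refine h.trans ?_
  rw [lintegral_option (by exact hm.ennreal_ofReal.mul hm'.ennreal_ofReal)]
  simp_rw [lintegral_greenField_none hWe.symm (hWe.diag _) hWe.nonneg
        fun i => (hR _).trans_le (boundaryWeight_comp_le hW R e i)]
  exact lintegral_pinnedDensity_of_isEmpty _ _

/-- Convergence of the weights implies setwise convergence of the laws. -/
theorem tendsto_pinnedMeasure {Wn : ℕ → V → V → ℝ} (hW : IsWeight W) (hWn : ∀ n, IsWeight (Wn n))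
    (hR : ∀ i, 0 ≤ boundaryWeight W R i) (hRn : ∀ n i, 0 ≤ boundaryWeight (Wn n) R i)
    (hlim : Tendsto Wn atTop (𝓝 W)) {S : Set (V → ℝ)} (hS : MeasurableSet S) :
    Tendsto (fun n => pinnedMeasure (Wn n) R S) atTop (𝓝 (pinnedMeasure W R S)) := by
  have := isProbabilityMeasure_pinnedMeasure hW hR
  have := fun n => isProbabilityMeasure_pinnedMeasure (hWn n) (hRn n)
  -- Fatou's lemma gives a lower bound on every measurable set. Used for S and its complement, with
  -- all total masses equal to one, it forces convergence.
  have hle : ∀ {T : Set (V → ℝ)}, MeasurableSet T →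
      pinnedMeasure W R T ≤ liminf (fun n => pinnedMeasure (Wn n) R T) atTop := by
    intro T hT
    simp only [pinnedMeasure, withDensity_apply _ hT]
    refine (lintegral_mono fun β => pinnedDensity_le_liminf (fun n => (hWn n).symm) hlim β).trans ?_
    exact lintegral_liminf_le fun n =>
      (measurable_pinnedDensity (hWn n).symm R).ennreal_ofReal
  exact tendsto_of_le_liminf_of_limsup_le (hle hS)
    (limsup_measure_le_of_le_liminf_measure_compl hS (hle hS.compl))

end Embeddings

/-! ### Uncoupled graphs -/

section BlockDiagonal

open Matrix

variable {U T : Type*} [Fintype U] [DecidableEq U] [Fintype T] [DecidableEq T]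

/-- The weights on a disjoint union of two graphs. -/
def sumWeight (W₁ : U → U → ℝ) (W₂ : T → T → ℝ) : U ⊕ T → U ⊕ T → ℝ :=
  fromBlocks (of W₁) 0 0 (of W₂)

variable {W₁ : U → U → ℝ} {W₂ : T → T → ℝ} {R : U ⊕ T → ℝ}

theorem isWeight_sumWeight (h₁ : IsWeight W₁) (h₂ : IsWeight W₂) : IsWeight (sumWeight W₁ W₂) where
  symm i j := by
    rcases i with i | i <;> rcases j with j | j
    exacts [h₁.symm i j, rfl, rfl, h₂.symm i j]
  diag i := by
    rcases i with i | i <;> simp [sumWeight, h₁.diag, h₂.diag]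
  nonneg i j := by
    rcases i with i | i <;> rcases j with j | j <;> simp [sumWeight, h₁.nonneg, h₂.nonneg]

theorem boundaryWeight_sumWeight :
    boundaryWeight (sumWeight W₁ W₂) R =
      Sum.elim (boundaryWeight W₁ fun i => R (.inl i)) (boundaryWeight W₂ fun i => R (.inr i)) := by
  ext i
  rcases i with i | i <;> simp [boundaryWeight, sumWeight]

theorem schrodinger_sumWeight (x : U ⊕ T → ℝ) :
    schrodinger (sumWeight W₁ W₂) x = fromBlocks (schrodinger W₁ fun i => x (.inl i)) 0 0
      (schrodinger W₂ fun i => x (.inr i)) := by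
  ext i j
  rcases i with i | i <;> rcases j with j | j <;>
    simp [sumWeight, schrodinger, Matrix.diagonal_apply, of_apply (fromBlocks _ _ _ _)]

theorem posDef_sumWeight_iff (x : U ⊕ T → ℝ) :
    (schrodinger (sumWeight W₁ W₂) x).PosDef ↔
      (schrodinger W₁ fun i => x (.inl i)).PosDef ∧ (schrodinger W₂ fun i => x (.inr i)).PosDef := by
  rw [schrodinger_sumWeight]
  set A := schrodinger W₁ fun i => x (.inl i)
  set B := schrodinger W₂ fun i => x (.inr i)
  constructor
  · intro h
    exact ⟨h.submatrix Sum.inl_injective, h.submatrix Sum.inr_injective⟩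
  · rintro ⟨hA, hB⟩
    refine .of_dotProduct_mulVec_pos (hA.1.fromBlocks (by simp) hB.1) fun y hy => ?_
    have hq : star y ⬝ᵥ (fromBlocks A 0 0 B *ᵥ y) =
        (y ∘ Sum.inl) ⬝ᵥ (A *ᵥ (y ∘ Sum.inl)) + (y ∘ Sum.inr) ⬝ᵥ (B *ᵥ (y ∘ Sum.inr)) := by
      rw [fromBlocks_mulVec]
      simp [dotProduct]
    have h1 := hA.posSemidef.dotProduct_mulVec_nonneg (y ∘ Sum.inl)
    have h2 := hB.posSemidef.dotProduct_mulVec_nonneg (y ∘ Sum.inr)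
    rw [hq]
    rw [star_trivial] at h1 h2
    by_cases h0 : y ∘ Sum.inl = 0
    · have h0' : y ∘ Sum.inr ≠ 0 := by
        intro h0'
        refine hy (funext fun i => ?_)
        rcases i with i | i
        · exact congrFun h0 i
        · exact congrFun h0' i
      have := hB.dotProduct_mulVec_pos h0'
      rw [star_trivial] at this
      linarith
    · have := hA.dotProduct_mulVec_pos h0
      rw [star_trivial] at this
      linarith

/-- Without edges between the parts H_β is block diagonal: determinants multiply and exponents add.
-/
theorem pinnedDensity_sumWeight (x : U ⊕ T → ℝ) :
    pinnedDensity (sumWeight W₁ W₂) R x =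
      pinnedDensity W₁ (fun i => R (.inl i)) (fun i => x (.inl i)) *
        pinnedDensity W₂ (fun i => R (.inr i)) (fun i => x (.inr i)) := by
  by_cases h : (schrodinger (sumWeight W₁ W₂) x).PosDef
  · obtain ⟨h1, h2⟩ := (posDef_sumWeight_iff x).1 h
    have hG : greenField (sumWeight W₁ W₂) R x =
        Sum.elim (greenField W₁ (fun i => R (.inl i)) fun i => x (.inl i))
          (greenField W₂ (fun i => R (.inr i)) fun i => x (.inr i)) := by
      symm
      refine eq_green_mulVec h ?_
      rw [schrodinger_sumWeight, boundaryWeight_sumWeight, fromBlocks_mulVec]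
      simp only [Sum.elim_comp_inl, Sum.elim_comp_inr, zero_mulVec, add_zero, zero_add]
      rw [greenField, greenField, schrodinger_mulVec_green h1, schrodinger_mulVec_green h2]
    rw [pinnedDensity_of_posDef _ h, pinnedDensity_of_posDef _ h1, pinnedDensity_of_posDef _ h2, hG,
      boundaryWeight_sumWeight, schrodinger_sumWeight, det_fromBlocks_zero₂₁,
      Real.sqrt_mul h1.det_pos.le, Fintype.card_sum, pow_add, div_mul_div_comm,
      mul_mul_mul_comm, ← Real.exp_add]
    congr 3
    simp only [sumElim_dotProduct_sumElim, Fintype.sum_sum_type, sumWeight, fromBlocks_apply₁₁,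
      fromBlocks_apply₁₂, fromBlocks_apply₂₁, fromBlocks_apply₂₂, of_apply, Matrix.zero_apply,
      Finset.sum_const_zero, add_zero, zero_add]
    ring
  · rw [pinnedDensity_of_not_posDef _ h]
    rw [posDef_sumWeight_iff, not_and_or] at h
    rcases h with h | h
    · rw [pinnedDensity_of_not_posDef _ h, zero_mul]
    · rw [pinnedDensity_of_not_posDef _ h, mul_zero]

theorem pinnedMeasure_sumWeight (h₁ : IsWeight W₁) (h₂ : IsWeight W₂) {A : Set (U → ℝ)}
    {B : Set (T → ℝ)} (hA : MeasurableSet A) (hB : MeasurableSet B) :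
    pinnedMeasure (sumWeight W₁ W₂) R
        {x | (fun i => x (.inl i)) ∈ A ∧ (fun i => x (.inr i)) ∈ B} =
      pinnedMeasure W₁ (fun i => R (.inl i)) A * pinnedMeasure W₂ (fun i => R (.inr i)) B := by
  have hS : MeasurableSet
      {x : U ⊕ T → ℝ | (fun i => x (.inl i)) ∈ A ∧ (fun i => x (.inr i)) ∈ B} :=
    (hA.preimage (by fun_prop)).inter (hB.preimage (by fun_prop))
  simp only [pinnedMeasure]
  rw [withDensity_apply _ hS, withDensity_apply _ hA, withDensity_apply _ hB,
    ← lintegral_indicator hS, ← lintegral_indicator hA, ← lintegral_indicator hB,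
    ← (volume_measurePreserving_sumPiEquivProdPi_symm fun _ : U ⊕ T => ℝ).lintegral_comp_emb
      (MeasurableEquiv.measurableEmbedding _), Measure.volume_eq_prod,
    ← lintegral_prod_mul
      (((measurable_pinnedDensity h₁.symm _).ennreal_ofReal.indicator hA).aemeasurable)
      (((measurable_pinnedDensity h₂.symm _).ennreal_ofReal.indicator hB).aemeasurable)]
  refine lintegral_congr fun p => ?_
  have e1 : (fun i => (MeasurableEquiv.sumPiEquivProdPi fun _ : U ⊕ T => ℝ).symm p (.inl i)) = p.1 :=
    rfl
  have e2 : (fun i => (MeasurableEquiv.sumPiEquivProdPi fun _ : U ⊕ T => ℝ).symm p (.inr i)) = p.2 :=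
    rfl
  by_cases h1 : p.1 ∈ A <;> by_cases h2 : p.2 ∈ B <;>
    simp [Set.indicator, e1, e2, h1, h2, pinnedDensity_sumWeight,
      ENNReal.ofReal_mul (pinnedDensity_nonneg _ _ _)]

end BlockDiagonal

/-! ### The geometry of the Dyson lattice -/

section Lattice

theorem mem_block_iff {i : ℕ+} {k n : ℕ} :
    (k * 2 ^ n < (i : ℕ) ∧ (i : ℕ) ≤ (k + 1) * 2 ^ n) ↔ ((i : ℕ) - 1) / 2 ^ n = k := by
  have h2 : 0 < 2 ^ n := by positivity
  have hi := i.pos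
  rw [Nat.div_eq_iff h2, add_mul, one_mul]
  constructor <;> intro h <;> constructor <;> omega

/-- The blocks of level n are the fibres of i ↦ (i - 1)/2^n, and a common block at one level
persists at higher levels. -/
theorem dysonDist_le_iff {i j : ℕ+} {n : ℕ} :
    dysonDist i j ≤ n ↔ ((i : ℕ) - 1) / 2 ^ n = ((j : ℕ) - 1) / 2 ^ n := by
  have hS : {n : ℕ | ∃ k : ℕ, (k * 2 ^ n < (i : ℕ) ∧ (i : ℕ) ≤ (k + 1) * 2 ^ n) ∧
      (k * 2 ^ n < (j : ℕ) ∧ (j : ℕ) ≤ (k + 1) * 2 ^ n)} =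
      {n : ℕ | ((i : ℕ) - 1) / 2 ^ n = ((j : ℕ) - 1) / 2 ^ n} := by
    ext n
    simp only [Set.mem_ofPred_eq, mem_block_iff]
    constructor
    · rintro ⟨k, h1, h2⟩
      rw [h1, h2]
    · intro h
      exact ⟨_, h, rfl⟩
  rw [dysonDist, hS]
  constructor
  · intro h
    have hne : {n : ℕ | ((i : ℕ) - 1) / 2 ^ n = ((j : ℕ) - 1) / 2 ^ n}.Nonempty := by
      -- At level i + j both quotients are zero, because i + j < 2^(i + j).
      refine ⟨i + j, ?_⟩
      have h1 : (i : ℕ) + j < 2 ^ ((i : ℕ) + j) := Nat.lt_two_pow_self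
      show _ = _
      rw [Nat.div_eq_of_lt (by omega), Nat.div_eq_of_lt (by omega)]
    have hmem := Nat.sInf_mem hne
    simp only [Set.mem_ofPred_eq] at hmem
    rw [← Nat.add_sub_cancel' h, pow_add, ← Nat.div_div_eq_div_mul, ← Nat.div_div_eq_div_mul, hmem]
  · intro h
    exact Nat.sInf_le h

theorem dysonDist_eq_of_forall_le_iff {i j i' j' : ℕ+}
    (h : ∀ n, dysonDist i j ≤ n ↔ dysonDist i' j' ≤ n) : dysonDist i j = dysonDist i' j' :=
  le_antisymm ((h _).2 le_rfl) ((h _).1 le_rfl)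

theorem dysonDist_comm (i j : ℕ+) : dysonDist i j = dysonDist j i :=
  dysonDist_eq_of_forall_le_iff fun n => by rw [dysonDist_le_iff, dysonDist_le_iff, eq_comm]

theorem mem_ball_iff {i : ℕ+} {n : ℕ} : i ∈ ball n ↔ (i : ℕ) ≤ 2 ^ n := by
  simp [ball, ← PNat.coe_le_coe]

theorem mem_ball_iff_dysonDist {i : ℕ+} {n : ℕ} : i ∈ ball n ↔ dysonDist 1 i ≤ n := by
  have h2 : 0 < 2 ^ n := by positivity
  have hi := i.pos
  rw [mem_ball_iff, dysonDist_le_iff, eq_comm]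
  simp only [PNat.one_coe, Nat.sub_self, Nat.zero_div]
  rw [Nat.div_eq_zero_iff_lt h2]
  omega

theorem ball_mono : Monotone ball := fun _ _ h _ hi =>
  mem_ball_iff_dysonDist.2 ((mem_ball_iff_dysonDist.1 hi).trans h)

theorem eventually_subset_ball (s : Finset ℕ+) : ∀ᶠ n in atTop, s ⊆ ball n := by
  have : ∀ i : ℕ+, ∀ᶠ n in atTop, i ∈ ball n := fun i => by
    filter_upwards [eventually_ge_atTop (dysonDist 1 i)] with n hn
    exact mem_ball_iff_dysonDist.2 hn
  exact (s.eventually_all.2 fun i _ => this i).mono fun n hn i hi => hn i hi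

/-- The distance is ultrametric, so Λ_n is the ball of radius n around each of its points, in
particular around σ 1. -/
theorem mem_ball_apply_iff {σ : Equiv.Perm ℕ+} (hσ : σ ∈ autGroup) {n : ℕ} (hn : σ 1 ∈ ball n)
    (i : ℕ+) : σ i ∈ ball n ↔ i ∈ ball n := by
  have h := hσ 1 i
  rw [mem_ball_iff_dysonDist, dysonDist_le_iff] at hn
  rw [mem_ball_iff_dysonDist, mem_ball_iff_dysonDist, ← h, dysonDist_le_iff, dysonDist_le_iff, hn]

theorem coe_two_pow (n : ℕ) : ((2 ^ n : ℕ+) : ℕ) = 2 ^ n := by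
  push_cast
  rfl

/-- On blocks of level m ≤ n the map acts as a swap of two runs of 2^(n - m) blocks, hence it sends
blocks to blocks. -/
theorem swapFun_sub_one_div {n m : ℕ} (hm : m ≤ n) (i : ℕ+) :
    ((swapFun n i : ℕ+) - 1 : ℕ) / 2 ^ m =
      if ((i : ℕ) - 1) / 2 ^ m < 2 ^ (n - m) then ((i : ℕ) - 1) / 2 ^ m + 2 ^ (n - m)
      else if ((i : ℕ) - 1) / 2 ^ m < 2 * 2 ^ (n - m) then ((i : ℕ) - 1) / 2 ^ m - 2 ^ (n - m)
      else ((i : ℕ) - 1) / 2 ^ m := by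
  have h2 : 0 < 2 ^ m := by positivity
  have hi := i.pos
  have hp : (2 : ℕ) ^ n = 2 ^ (n - m) * 2 ^ m := by rw [← pow_add, Nat.sub_add_cancel hm]
  have hp' : (2 : ℕ) ^ (n + 1) = 2 * 2 ^ (n - m) * 2 ^ m := by rw [pow_succ, hp]; ring
  have q1 : ((i : ℕ) - 1) / 2 ^ m < 2 ^ (n - m) ↔ (i : ℕ) - 1 < 2 ^ n := by
    rw [Nat.div_lt_iff_lt_mul h2, ← hp]
  have q2 : ((i : ℕ) - 1) / 2 ^ m < 2 * 2 ^ (n - m) ↔ (i : ℕ) - 1 < 2 ^ (n + 1) := by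
    rw [Nat.div_lt_iff_lt_mul h2, ← hp']
  simp only [q1, q2]
  have hs : (2 : ℕ) ^ (n + 1) = 2 * 2 ^ n := by ring
  unfold swapFun
  simp only [← PNat.coe_le_coe, coe_two_pow]
  have e1 : (i : ℕ) ≤ 2 ^ n ↔ (i : ℕ) - 1 < 2 ^ n := by omega
  have e2 : (i : ℕ) ≤ 2 ^ (n + 1) ↔ (i : ℕ) - 1 < 2 ^ (n + 1) := by omega
  by_cases h1 : (i : ℕ) - 1 < 2 ^ n
  · rw [if_pos (e1.2 h1), if_pos h1, PNat.add_coe, coe_two_pow,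
      show (i : ℕ) + 2 ^ n - 1 = (i - 1) + 2 ^ (n - m) * 2 ^ m by omega,
      Nat.add_mul_div_right _ _ h2]
  · rw [if_neg (mt e1.1 h1), if_neg h1]
    by_cases h3 : (i : ℕ) - 1 < 2 ^ (n + 1)
    · have hlt : (2 ^ n : ℕ+) < i := by
        rw [← PNat.coe_lt_coe, coe_two_pow]
        omega
      rw [if_pos (e2.2 h3), if_pos h3, PNat.sub_coe, if_pos hlt, coe_two_pow,
        show (i : ℕ) - 2 ^ n - 1 = (i - 1) - 2 ^ m * 2 ^ (n - m) by rw [mul_comm, ← hp]; omega,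
        Nat.sub_mul_div]
    · rw [if_neg (mt e2.1 h3), if_neg h3]

theorem swapFun_sub_one_div_of_lt {n m : ℕ} (hm : n < m) (i : ℕ+) :
    ((swapFun n i : ℕ+) - 1 : ℕ) / 2 ^ m = ((i : ℕ) - 1) / 2 ^ m := by
  obtain ⟨k, rfl⟩ := Nat.exists_eq_add_of_lt hm
  have h : ((swapFun n i : ℕ+) - 1 : ℕ) / 2 ^ (n + 1) = ((i : ℕ) - 1) / 2 ^ (n + 1) := by
    have h0 := swapFun_sub_one_div le_rfl i (n := n)
    rw [pow_succ, ← Nat.div_div_eq_div_mul, ← Nat.div_div_eq_div_mul, h0]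
    simp only [Nat.sub_self, pow_zero, mul_one]
    generalize ((i : ℕ) - 1) / 2 ^ n = q
    split_ifs <;> omega
  rw [show n + k + 1 = (n + 1) + k by ring, pow_add, ← Nat.div_div_eq_div_mul,
    ← Nat.div_div_eq_div_mul, h]

theorem dysonDist_swapFun_le {n m : ℕ} {i j : ℕ+} (h : dysonDist i j ≤ m) :
    dysonDist (swapFun n i) (swapFun n j) ≤ m := by
  rw [dysonDist_le_iff] at h ⊢
  rcases le_or_gt m n with hm | hm
  · rw [swapFun_sub_one_div hm, swapFun_sub_one_div hm, h]
  · rw [swapFun_sub_one_div_of_lt hm, swapFun_sub_one_div_of_lt hm, h]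

theorem swap_mem_autGroup (n : ℕ) : swap n ∈ autGroup := by
  by_cases hn : n = 0
  · rw [swap, if_pos hn]
    exact one_mem _
  · rw [swap, if_neg hn]
    refine fun i j => dysonDist_eq_of_forall_le_iff fun m => ⟨fun h => ?_, dysonDist_swapFun_le⟩
    have := dysonDist_swapFun_le (n := n) h
    simpa only [Function.Involutive.coe_toPerm, swapFun_involutive n _] using this

theorem swapGroup_le_autGroup : swapGroup ≤ autGroup := by
  rw [swapGroup, Subgroup.closure_le]
  rintro _ ⟨n, rfl⟩
  exact swap_mem_autGroup n

theorem lt_dysonDist_swap {n : ℕ} (hn : n ≠ 0) {i j : ℕ+} (hi : i ∈ ball n) (hj : j ∈ ball n) :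
    n < dysonDist i (swap n j) := by
  rw [← not_le, dysonDist_le_iff]
  have h2 : 0 < 2 ^ n := by positivity
  have hi' := i.pos
  have hj' := j.pos
  rw [mem_ball_iff] at hi hj
  rw [swap, if_neg hn, Function.Involutive.coe_toPerm, swapFun_sub_one_div le_rfl,
    Nat.div_eq_of_lt (by omega), Nat.div_eq_of_lt (by omega)]
  simp

end Lattice

/-! ### The weights of the Dyson lattice -/

section Weights

variable {Wbar ρ : ℝ}

/-- The total weight at a vertex. -/
def totalWeight (Wbar ρ : ℝ) (i : ℕ+) : ℝ := ∑' j, dysonWeight Wbar ρ i j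

theorem isWeight_dysonWeight (hW : 0 < Wbar) (hρ : 1 < ρ) : IsWeight (dysonWeight Wbar ρ) where
  symm i j := by simp only [dysonWeight, dysonDist_comm i j, eq_comm]
  diag i := by simp [dysonWeight]
  nonneg i j := by
    unfold dysonWeight
    split_ifs <;> positivity

theorem dysonWeight_pos (hW : 0 < Wbar) (hρ : 1 < ρ) {i j : ℕ+} (h : i ≠ j) :
    0 < dysonWeight Wbar ρ i j := by
  rw [dysonWeight, if_neg h]
  positivity

theorem dysonWeight_apply {σ : Equiv.Perm ℕ+} (hσ : σ ∈ autGroup) (i j : ℕ+) :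
    dysonWeight Wbar ρ (σ i) (σ j) = dysonWeight Wbar ρ i j := by
  simp only [dysonWeight, σ.injective.eq_iff, hσ i j]

theorem totalWeight_apply {σ : Equiv.Perm ℕ+} (hσ : σ ∈ autGroup) (i : ℕ+) :
    totalWeight Wbar ρ (σ i) = totalWeight Wbar ρ i := by
  rw [totalWeight, ← σ.tsum_eq]
  simp only [dysonWeight_apply hσ, totalWeight]

theorem summable_dysonWeight (hW : 0 < Wbar) (hρ : 1 < ρ) (i : ℕ+) :
    Summable (dysonWeight Wbar ρ i) := by
  -- With 2^p = 2ρ, the bound j ≤ i 2^d gives (2ρ)^(-d) ≤ (i/j)^p, which is summable in j since ρ >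
  -- 1 means p > 1.
  set p := Real.logb 2 (2 * ρ) with hp
  have hp1 : 1 < p := by
    rw [hp, Real.lt_logb_iff_rpow_lt (by norm_num) (by positivity), Real.rpow_one]
    linarith
  have h2p : (2 : ℝ) ^ p = 2 * ρ := Real.rpow_logb (by norm_num) (by norm_num) (by positivity)
  have hs : Summable fun j : ℕ+ => Wbar * (i : ℝ) ^ p * (((j : ℕ) : ℝ) ^ p)⁻¹ :=
    ((Real.summable_nat_rpow_inv.2 hp1).comp_injective PNat.coe_injective).mul_left _
  refine hs.of_nonneg_of_le ((isWeight_dysonWeight hW hρ).nonneg i) fun j => ?_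
  have hi : (0 : ℝ) < i := by exact_mod_cast i.pos
  have hj : (0 : ℝ) < (j : ℕ) := by exact_mod_cast j.pos
  unfold dysonWeight
  split_ifs with h
  · positivity
  · rw [mul_assoc]
    refine mul_le_mul_of_nonneg_left ?_ hW.le
    set d := dysonDist i j
    have hle : (j : ℕ) ≤ i * 2 ^ d := by
      have h1 := (dysonDist_le_iff (i := i) (j := j) (n := d)).1 le_rfl
      have h2 : 0 < 2 ^ d := by positivity
      have h3 := Nat.lt_div_mul_add h2 (a := (j : ℕ) - 1)
      have h4 := Nat.div_mul_le_self ((i : ℕ) - 1) (2 ^ d)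
      rw [← h1] at h3
      have h5 : (i : ℕ) - 1 ≤ (i - 1) * 2 ^ d := Nat.le_mul_of_pos_right _ h2
      have h6 : ((i : ℕ) - 1) * 2 ^ d + 2 ^ d = i * 2 ^ d := by
        rw [← Nat.succ_mul, Nat.succ_eq_add_one, Nat.sub_add_cancel i.pos]
      omega
    have hle' : ((j : ℕ) : ℝ) ≤ i * 2 ^ d := by exact_mod_cast hle
    have hpow : ((j : ℕ) : ℝ) ^ p ≤ (i : ℝ) ^ p * (2 * ρ) ^ d := by
      calc ((j : ℕ) : ℝ) ^ p ≤ ((i : ℝ) * 2 ^ d) ^ p :=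
            Real.rpow_le_rpow hj.le hle' (by linarith)
        _ = (i : ℝ) ^ p * (2 * ρ) ^ d := by
            rw [Real.mul_rpow hi.le (by positivity), ← h2p, ← Real.rpow_natCast,
              ← Real.rpow_natCast, ← Real.rpow_mul (by norm_num), ← Real.rpow_mul (by norm_num),
              mul_comm p]
    rw [← div_eq_mul_inv, inv_le_iff_one_le_mul₀ (by positivity), div_mul_eq_mul_div,
      one_le_div (by positivity)]
    exact hpow

/-- A finite set misses some vertex, and every vertex is joined to it with positive weight. -/
theorem boundaryWeight_dyson_pos (hW : 0 < Wbar) (hρ : 1 < ρ) {U : Type*} [Fintype U] (e : U ↪ ℕ+)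
    (i : U) : 0 < boundaryWeight (fun i j => dysonWeight Wbar ρ (e i) (e j))
      (fun i => totalWeight Wbar ρ (e i)) i := by
  classical
  obtain ⟨j, hj⟩ := Infinite.exists_notMem_finset (Finset.univ.map e)
  have h := (summable_dysonWeight hW hρ (e i)).sum_le_tsum (insert j (Finset.univ.map e))
    fun k _ => (isWeight_dysonWeight hW hρ).nonneg _ _
  rw [Finset.sum_insert hj, Finset.sum_map] at h
  have hpos : 0 < dysonWeight Wbar ρ (e i) j := dysonWeight_pos hW hρ fun h => hj (by simp [← h])
  rw [boundaryWeight, totalWeight]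
  linarith

theorem isWeight_wiredWeight (hW : 0 < Wbar) (hρ : 1 < ρ) (n : ℕ) :
    IsWeight (wiredWeight Wbar ρ n) where
  symm i j := by
    rcases i with _ | i <;> rcases j with _ | j
    exacts [rfl, rfl, rfl, (isWeight_dysonWeight hW hρ).symm _ _]
  diag i := by
    rcases i with _ | i
    exacts [rfl, (isWeight_dysonWeight hW hρ).diag _]
  nonneg i j := by
    rcases i with _ | i <;> rcases j with _ | j
    exacts [le_rfl, tsum_nonneg fun _ => (isWeight_dysonWeight hW hρ).nonneg _ _,
      tsum_nonneg fun _ => (isWeight_dysonWeight hW hρ).nonneg _ _,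
      (isWeight_dysonWeight hW hρ).nonneg _ _]

/-- This makes the function `R` independent of the ball. -/
theorem sum_wiredWeight_some (hW : 0 < Wbar) (hρ : 1 < ρ) (n : ℕ) (i : ball n) :
    ∑ j, wiredWeight Wbar ρ n (some i) j = totalWeight Wbar ρ i := by
  rw [Fintype.sum_option]
  simp only [wiredWeight]
  rw [Finset.sum_coe_sort (ball n) fun j => dysonWeight Wbar ρ i j, add_comm, totalWeight]
  exact (summable_dysonWeight hW hρ i).sum_add_tsum_subtype_compl (ball n)

theorem tendsto_dysonWeight_swap (hρ : 1 < ρ) (i j : ℕ+) :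
    Tendsto (fun n => dysonWeight Wbar ρ i (swap n j)) atTop (𝓝 0) := by
  have hlim : Tendsto (fun n : ℕ => |Wbar| * ((2 * ρ) ^ n)⁻¹) atTop (𝓝 0) := by
    rw [← mul_zero |Wbar|]
    exact (tendsto_inv_atTop_zero.comp
      (tendsto_pow_atTop_atTop_of_one_lt (by linarith))).const_mul _
  refine squeeze_zero_norm' ?_ hlim
  filter_upwards [eventually_subset_ball {i, j}, eventually_ne_atTop 0] with n hn hn0
  have hd := lt_dysonDist_swap hn0 (hn (by simp : i ∈ _)) (hn (by simp : j ∈ _))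
  unfold dysonWeight
  split_ifs with h
  · simp only [norm_zero]
    positivity
  · rw [norm_mul, Real.norm_eq_abs, Real.norm_of_nonneg (by positivity)]
    have : (2 * ρ) ^ n ≤ (2 * ρ) ^ dysonDist i (swap n j) :=
      pow_le_pow_right₀ (by linarith) hd.le
    gcongr

end Weights

/-! ### Stationarity and mixing -/

section Mixing

/-- Setwise convergence of dominated measures can be checked on a generating π-system. -/
theorem tendsto_measure_of_piSystem {X : Type*} [m : MeasurableSpace X] {μ ν : Measure X}
    [IsFiniteMeasure μ] {νn : ℕ → Measure X} (hle : ∀ n, νn n ≤ μ) {C : Set (Set X)}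
    (hgen : m = MeasurableSpace.generateFrom C) (hpi : IsPiSystem C)
    (huniv : Tendsto (fun n => νn n Set.univ) atTop (𝓝 (ν Set.univ)))
    (hC : ∀ s ∈ C, Tendsto (fun n => νn n s) atTop (𝓝 (ν s))) {s : Set X} (hs : MeasurableSet s) :
    Tendsto (fun n => νn n s) atTop (𝓝 (ν s)) := by
  have hfin : ∀ n, IsFiniteMeasure (νn n) := fun n => isFiniteMeasure_of_le μ (hle n)
  have hν : IsFiniteMeasure ν := ⟨(le_of_tendsto' huniv fun n => hle n _).trans_lt
    (measure_lt_top μ _)⟩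
  induction s, hs using MeasurableSpace.induction_on_inter hgen hpi with
  | empty => simp
  | basic t ht => exact hC t ht
  | compl t ht ih =>
    have hc : ∀ n, νn n tᶜ = νn n Set.univ - νn n t := fun n =>
      measure_compl ht (measure_ne_top _ _)
    simp only [hc, measure_compl ht (measure_ne_top ν t)]
    exact ENNReal.Tendsto.sub huniv ih (.inl (measure_ne_top _ _))
  | iUnion f hd hf ih =>
    -- Dominated convergence for the series, with the summable majorant μ(f i).
    simp only [measure_iUnion hd hf, ← lintegral_count]
    refine tendsto_lintegral_of_dominated_convergence (fun i => μ (f i))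
      (fun _ => measurable_of_countable _) (fun n => ae_of_all _ fun i => hle n _) ?_
      (ae_of_all _ ih)
    rw [lintegral_count, ← measure_iUnion hd hf]
    exact measure_ne_top _ _

/-- Mixing can be checked on a generating π-system. -/
theorem mixing_of_piSystem {X : Type*} [m : MeasurableSpace X] {μ : Measure X}
    [IsProbabilityMeasure μ] {T : ℕ → X → X} (hT : ∀ n, MeasurePreserving (T n) μ μ)
    {C : Set (Set X)} (hgen : m = MeasurableSpace.generateFrom C) (hpi : IsPiSystem C)
    (hC : ∀ s ∈ C, ∀ t ∈ C,
      Tendsto (fun n => μ (T n ⁻¹' t ∩ s)) atTop (𝓝 (μ t * μ s)))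
    {s t : Set X} (hs : MeasurableSet s) (ht : MeasurableSet t) :
    Tendsto (fun n => μ (T n ⁻¹' t ∩ s)) atTop (𝓝 (μ t * μ s)) := by
  have hmeas : ∀ t ∈ C, MeasurableSet t := fun t ht => by
    rw [hgen]
    exact MeasurableSpace.measurableSet_generateFrom ht
  -- The two sets are freed one at a time: first s, with μ restricted to the preimage of t, then t,
  -- with the image of μ restricted to s.
  have step : ∀ t ∈ C, ∀ s, MeasurableSet s →
      Tendsto (fun n => μ (T n ⁻¹' t ∩ s)) atTop (𝓝 (μ t * μ s)) := by
    intro t ht s hs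
    have h := tendsto_measure_of_piSystem (ν := μ t • μ) (νn := fun n => μ.restrict (T n ⁻¹' t))
      (fun n => Measure.restrict_le_self) hgen hpi (by
        simp [(hT _).measure_preimage (hmeas t ht).nullMeasurableSet]) (fun s hs => by
        simpa only [Measure.restrict_apply (hmeas s hs), Set.inter_comm s, Measure.smul_apply,
          smul_eq_mul] using hC s hs t ht) hs
    simpa only [Measure.restrict_apply hs, Set.inter_comm s, Measure.smul_apply,
      smul_eq_mul] using h
  have happ : ∀ (n : ℕ) (t : Set X), MeasurableSet t →
      (μ.restrict s).map (T n) t = μ (T n ⁻¹' t ∩ s) := fun n t ht => by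
    rw [Measure.map_apply (hT n).measurable ht, Measure.restrict_apply ((hT n).measurable ht)]
  have h := tendsto_measure_of_piSystem (μ := μ) (ν := μ s • μ)
    (νn := fun n => (μ.restrict s).map (T n)) (fun n => by
      conv_rhs => rw [← (hT n).map_eq]
      exact Measure.map_mono Measure.restrict_le_self (hT n).measurable) hgen hpi
    (by simp [happ _ _ MeasurableSet.univ]) (fun t ht => by
      simpa only [happ _ _ (hmeas t ht), Measure.smul_apply, smul_eq_mul, mul_comm (μ s)]
        using step t ht s hs) ht
  simpa only [happ _ _ ht, Measure.smul_apply, smul_eq_mul, mul_comm (μ s)] using h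

variable {Wbar ρ : ℝ} {μ : Measure (ℕ+ → ℝ)}

/-- `μ` is the law of the `β`-field: its finite-dimensional marginals are the pinned measures. -/
def HasDysonMarginals (Wbar ρ : ℝ) (μ : Measure (ℕ+ → ℝ)) : Prop :=
  ∀ ⦃U : Type⦄ [Fintype U] [DecidableEq U] (e : U ↪ ℕ+), μ.map (fun x i => x (e i)) =
    pinnedMeasure (fun i j => dysonWeight Wbar ρ (e i) (e j)) fun i => totalWeight Wbar ρ (e i)

theorem aemeasurable_of_hasLaw {Ω : Type*} [MeasurableSpace Ω] {P : Measure Ω}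
    {β : Ω → ℕ+ → ℝ} {βδ : ℕ → Ω → ℝ}
    (hβ : ∀ n : ℕ, HasLaw (fun ω => augment n (β ω) (βδ n ω))
      (h22Measure (wiredWeight Wbar ρ n)) P) : AEMeasurable β P := by
  refine aemeasurable_pi_iff.2 fun i => ?_
  obtain ⟨n, hn⟩ := (eventually_subset_ball {i}).exists
  exact aemeasurable_pi_iff.1 (hβ n).aemeasurable (some ⟨i, hn (by simp)⟩)

theorem hasDysonMarginals_of_hasLaw (hW : 0 < Wbar) (hρ : 1 < ρ) {Ω : Type*} [MeasurableSpace Ω]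
    {P : Measure Ω} {β : Ω → ℕ+ → ℝ} {βδ : ℕ → Ω → ℝ}
    (hβ : ∀ n : ℕ, HasLaw (fun ω => augment n (β ω) (βδ n ω))
      (h22Measure (wiredWeight Wbar ρ n)) P) : HasDysonMarginals Wbar ρ (P.map β) := by
  intro U _ _ e
  obtain ⟨n, hn⟩ := (eventually_subset_ball (Finset.univ.map e)).exists
  have hn' : ∀ i, e i ∈ ball n := fun i => hn (by simp)
  set e' : U ↪ Option (ball n) := ⟨fun i => some ⟨e i, hn' i⟩, fun i j h => by simpa using h⟩
  have h := map_pinnedMeasure (isWeight_wiredWeight hW hρ n)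
    (R := fun i => ∑ j, wiredWeight Wbar ρ n i j) (fun i => by simp [boundaryWeight]) e'
  rw [← h22Measure_eq_pinnedMeasure, ← (hβ n).map_eq,
    AEMeasurable.map_map_of_aemeasurable (Measurable.aemeasurable (by fun_prop))
      (hβ n).aemeasurable] at h
  rw [AEMeasurable.map_map_of_aemeasurable (Measurable.aemeasurable (by fun_prop))
    (aemeasurable_of_hasLaw hβ)]
  refine h.trans ?_
  congr 1
  ext i
  exact sum_wiredWeight_some hW hρ n ⟨e i, hn' i⟩

/-- The marginals depend on the embedding only through weights and total weights, which
automorphisms preserve, and they determine the law. -/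
theorem measurePreserving_of_mem_autGroup [IsProbabilityMeasure μ]
    (hμ : HasDysonMarginals Wbar ρ μ) {σ : Equiv.Perm ℕ+} (hσ : σ ∈ autGroup) :
    MeasurePreserving (fun (x : ℕ+ → ℝ) i => x (σ i)) μ μ := by
  have hm : Measurable fun (x : ℕ+ → ℝ) i => x (σ i) := by fun_prop
  refine ⟨hm, ?_⟩
  refine IsProjectiveLimit.unique (P := fun I => μ.map I.restrict) (fun I => ?_) fun I => rfl
  rw [Measure.map_map (by fun_prop) hm]
  have h1 := hμ ((Function.Embedding.subtype (· ∈ I)).trans σ.toEmbedding)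
  have h2 := hμ (Function.Embedding.subtype (· ∈ I))
  simp only [Function.Embedding.trans_apply, Equiv.coe_toEmbedding, dysonWeight_apply hσ,
    totalWeight_apply hσ] at h1
  exact h1.trans h2.symm

/-- For large n the sets s and g_n(t) are disjoint, so the joint law is pinned on s ⊕ t. Only the
weights between the two parts vary with n, and they vanish in the limit. -/
theorem tendsto_cylinder_inter (hW : 0 < Wbar) (hρ : 1 < ρ) [IsProbabilityMeasure μ]
    (hμ : HasDysonMarginals Wbar ρ μ) (s t : Finset ℕ+) {A : Set (s → ℝ)} {B : Set (t → ℝ)}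
    (hA : MeasurableSet A) (hB : MeasurableSet B) :
    Tendsto (fun n => μ ((fun (x : ℕ+ → ℝ) i => x (swap n i)) ⁻¹' cylinder t B ∩ cylinder s A))
      atTop (𝓝 (μ (cylinder t B) * μ (cylinder s A))) := by
  obtain ⟨N, hN⟩ := eventually_atTop.1
    ((eventually_subset_ball (s ∪ t)).and (eventually_ne_atTop 0))
  rw [← tendsto_add_atTop_iff_nat N]
  have hinj : ∀ n, Function.Injective
      (Sum.elim (fun i : s => (i : ℕ+)) fun i : t => swap (n + N) i) := by
    intro n
    obtain ⟨h1, h2⟩ := hN (n + N) (Nat.le_add_left _ _)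
    refine Function.Injective.sumElim Subtype.coe_injective
      ((swap _).injective.comp Subtype.coe_injective) fun i j h => ?_
    have := lt_dysonDist_swap h2 (h1 (Finset.mem_union_left _ i.2))
      (h1 (Finset.mem_union_right _ j.2))
    rw [← h] at this
    exact absurd (dysonDist_le_iff.2 rfl) (not_le.2 this)
  set e : ℕ → s ⊕ t ↪ ℕ+ := fun n => ⟨_, hinj n⟩
  set R : s ⊕ t → ℝ := Sum.elim (fun i => totalWeight Wbar ρ i) fun i => totalWeight Wbar ρ i
    with hR
  have hRe : ∀ n, (fun i => totalWeight Wbar ρ (e n i)) = R := fun n => by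
    ext i
    rcases i with i | i
    exacts [rfl, totalWeight_apply (swap_mem_autGroup _) _]
  have hdw := isWeight_dysonWeight hW hρ
  set es := Function.Embedding.subtype (· ∈ s)
  set et := Function.Embedding.subtype (· ∈ t)
  have hS : MeasurableSet
      {x : s ⊕ t → ℝ | (fun i => x (.inl i)) ∈ A ∧ (fun i => x (.inr i)) ∈ B} :=
    (hA.preimage (by fun_prop)).inter (hB.preimage (by fun_prop))
  have key := tendsto_pinnedMeasure (R := R)
    (isWeight_sumWeight (hdw.comp es) (hdw.comp et))
    (fun n => hdw.comp (e n)) (fun i => by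
      rw [boundaryWeight_sumWeight]
      rcases i with i | i
      exacts [(boundaryWeight_dyson_pos hW hρ es i).le, (boundaryWeight_dyson_pos hW hρ et i).le])
    (fun n i => by
      rw [← hRe n]
      exact (boundaryWeight_dyson_pos hW hρ (e n) i).le)
    (tendsto_pi_nhds.2 fun i => tendsto_pi_nhds.2 fun j => by
      have hlim : ∀ i j, Tendsto (fun n => dysonWeight Wbar ρ i (swap (n + N) j)) atTop (𝓝 0) :=
        fun i j => (tendsto_dysonWeight_swap hρ i j).comp (tendsto_add_atTop_nat N)
      rcases i with i | i <;> rcases j with j | j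
      · exact tendsto_const_nhds
      · exact hlim _ _
      · exact (hlim j i).congr fun n => hdw.symm _ _
      · exact tendsto_const_nhds.congr fun n => (dysonWeight_apply (swap_mem_autGroup _) _ _).symm)
    hS
  rw [pinnedMeasure_sumWeight (hdw.comp es) (hdw.comp et) hA hB] at key
  have hs := hμ es
  have ht := hμ et
  simp only [hR, Sum.elim_inl, Sum.elim_inr] at key
  change Tendsto _ _ (𝓝 (pinnedMeasure _ (fun i => totalWeight Wbar ρ (es i)) A *
    pinnedMeasure _ (fun i => totalWeight Wbar ρ (et i)) B)) at key
  rw [← hs, ← ht, Measure.map_apply (by fun_prop) hA, Measure.map_apply (by fun_prop) hB,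
    mul_comm] at key
  refine key.congr fun n => ?_
  rw [← hR, ← hRe n, ← hμ (e n), Measure.map_apply (by fun_prop) hS]
  congr 1
  ext x
  exact and_comm

theorem mixing_swap (hW : 0 < Wbar) (hρ : 1 < ρ) [IsProbabilityMeasure μ]
    (hμ : HasDysonMarginals Wbar ρ μ) {E F : Set (ℕ+ → ℝ)} (hE : MeasurableSet E)
    (hF : MeasurableSet F) :
    Tendsto (fun n => μ ((fun (x : ℕ+ → ℝ) i => x (swap n i)) ⁻¹' F ∩ E)) atTop
      (𝓝 (μ F * μ E)) := by
  refine mixing_of_piSystem (fun n => measurePreserving_of_mem_autGroup hμ (swap_mem_autGroup n))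
    generateFrom_measurableCylinders.symm isPiSystem_measurableCylinders ?_ hE hF
  intro s hs t ht
  obtain ⟨I, A, hA, rfl⟩ := (mem_measurableCylinders _).1 hs
  obtain ⟨J, B, hB, rfl⟩ := (mem_measurableCylinders _).1 ht
  exact tendsto_cylinder_inter hW hρ hμ I J hA hB

theorem stationaryErgodic_of_mixing [IsProbabilityMeasure μ] {Γ : Subgroup (Equiv.Perm ℕ+)}
    (hswap : ∀ n, swap n ∈ Γ)
    (hΓ : ∀ σ ∈ Γ, MeasurePreserving (fun (x : ℕ+ → ℝ) i => x (σ i)) μ μ)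
    (hmix : ∀ E, MeasurableSet E → Tendsto
      (fun n => μ ((fun (x : ℕ+ → ℝ) i => x (swap n i)) ⁻¹' E ∩ E)) atTop (𝓝 (μ E * μ E))) :
    StationaryErgodic Γ μ where
  measure_preimage_smul c s hs :=
    (hΓ _ (DomMulAct.mk.symm c).2).measure_preimage hs.nullMeasurableSet
  aeconst_of_forall_preimage_smul_ae_eq {s} hs hinv := by
    have hconst : ∀ n, μ ((fun (x : ℕ+ → ℝ) i => x (swap n i)) ⁻¹' s ∩ s) = μ s := fun n => by
      have h : (fun (x : ℕ+ → ℝ) i => x (swap n i)) ⁻¹' s =ᵐ[μ] s :=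
        hinv (DomMulAct.mk ⟨swap n, hswap n⟩)
      rw [measure_congr (h.inter (ae_eq_refl s)), Set.inter_self]
    have hsq : μ s = μ s * μ s :=
      tendsto_nhds_unique (by simpa only [hconst] using tendsto_const_nhds) (hmix s hs)
    rw [eventuallyConst_set']
    by_cases h0 : μ s = 0
    · exact .inl (ae_eq_empty.2 h0)
    · refine .inr (ae_eq_univ.2 ((prob_compl_eq_zero_iff hs).2 ?_))
      exact ((ENNReal.mul_right_inj h0 (measure_ne_top _ _)).1
        (by rw [mul_one]; exact hsq)).symm

end Mixing

/-! ### The field `ψ` -/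

section PsiField

open Matrix

/-- The normalised Green function with pole at the new vertex. -/
theorem green_div_green_none {U : Type*} [Fintype U] [DecidableEq U] {W : Option U → Option U → ℝ}
    {β : U → ℝ} {b : ℝ} (hW : ∀ i j, W i j = W j i) (hd : W none none = 0)
    (h : (schrodinger W (extendPotential β b)).PosDef) (i : U) :
    green W (extendPotential β b) (some i) none / green W (extendPotential β b) none none =
      (green (oldWeight W) β *ᵥ rootWeight W) i := by
  obtain ⟨h1, hs⟩ := (posDef_option_iff hW hd).1 h
  -- This vector equals 1 at the pole and satisfies H y = 0 elsewhere, so it is a multiple of the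
  -- Green function with that pole.
  set y : Option U → ℝ := fun i => i.elim 1 (green (oldWeight W) β *ᵥ rootWeight W) with hy
  have hmul : schrodinger W (extendPotential β b) *ᵥ y =
      schurComplement W β b • Pi.single none 1 := by
    ext j
    cases j with
    | none =>
      rw [schrodinger_mulVec_none hd]
      simp [hy, schurComplement]
    | some j =>
      rw [schrodinger_mulVec_some hW]
      have := congrFun (schrodinger_mulVec_green h1 (rootWeight W)) j
      simp only [hy, Option.elim]
      change (schrodinger (oldWeight W) β *ᵥ (green (oldWeight W) β *ᵥ rootWeight W)) j - _ = _
      rw [this]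
      simp
  have hcol := eq_green_mulVec h hmul
  rw [mulVec_smul, mulVec_single_one] at hcol
  have e1 := congrFun hcol (some i)
  have e2 := congrFun hcol none
  simp only [hy, Option.elim, Pi.smul_apply, col_apply, smul_eq_mul] at e1 e2
  rw [e1]
  have h0 : green W (extendPotential β b) none none ≠ 0 := right_ne_zero_of_mul (e2 ▸ one_ne_zero)
  rw [div_eq_iff h0]
  linear_combination green W (extendPotential β b) (some i) none * e2

variable {Wbar ρ : ℝ} {μ : Measure (ℕ+ → ℝ)}

/-- The approximation of `ψ` on the ball `Λ_n`, as a function of the potential on `Λ_n` only. -/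
def psiField (Wbar ρ : ℝ) (n : ℕ) (x : ℕ+ → ℝ) (i : ℕ+) : ℝ :=
  if hi : i ∈ ball n then
    greenField (fun j k : ball n => dysonWeight Wbar ρ j k) (fun j => totalWeight Wbar ρ j)
      (fun j => x j) ⟨i, hi⟩
  else 1

/-- The weights to δ_n are exactly the boundary weights of Λ_n, so the potential at δ_n drops out.
-/
theorem psiApprox_eq_psiField (hW : 0 < Wbar) (hρ : 1 < ρ) {n : ℕ} {x : ℕ+ → ℝ} {b : ℝ}
    (h : (schrodinger (wiredWeight Wbar ρ n) (augment n x b)).PosDef) (i : ℕ+) :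
    psiApprox Wbar ρ n x b i = psiField Wbar ρ n x i := by
  have haug : augment n x b = extendPotential (fun j : ball n => x j) b := by
    ext j
    cases j <;> rfl
  rw [haug] at h
  have hw := isWeight_wiredWeight hW hρ n
  unfold psiApprox psiField
  split_ifs with hi
  · rw [haug, green_div_green_none hw.symm (hw.diag _) h, greenField]
    congr 2
    ext j
    have := sum_wiredWeight_some hW hρ n j
    rw [Fintype.sum_option] at this
    rw [boundaryWeight, ← this]
    exact (add_sub_cancel_right _ _).symm
  · rfl

theorem measurable_psiField (Wbar ρ : ℝ) (n : ℕ) (i : ℕ+) :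
    Measurable fun x => psiField Wbar ρ n x i := by
  unfold psiField
  split_ifs with hi
  · exact (measurable_greenField_apply _ _ _).comp (by fun_prop)
  · exact measurable_const

theorem psiField_comp {σ : Equiv.Perm ℕ+} (hσ : σ ∈ autGroup) {n : ℕ} (hn : σ 1 ∈ ball n)
    (x : ℕ+ → ℝ) (i : ℕ+) :
    psiField Wbar ρ n (fun j => x (σ j)) i = psiField Wbar ρ n x (σ i) := by
  have hmem := mem_ball_apply_iff hσ hn
  unfold psiField
  by_cases hi : i ∈ ball n
  · rw [dif_pos hi, dif_pos ((hmem i).2 hi)]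
    have h := greenField_comp_equiv (fun j k : ball n => dysonWeight Wbar ρ j k)
      (fun j => totalWeight Wbar ρ j) (fun j => x j)
      (σ.subtypeEquiv fun j => (hmem j).symm) ⟨i, hi⟩
    simp only [Equiv.subtypeEquiv_apply, dysonWeight_apply hσ, totalWeight_apply hσ] at h
    exact h
  · rw [dif_neg hi, dif_neg (mt (hmem i).1 hi)]

theorem psiField_nonneg_ae (hW : 0 < Wbar) (hρ : 1 < ρ) (hμ : HasDysonMarginals Wbar ρ μ) (n : ℕ)
    (i : ℕ+) : ∀ᵐ x ∂μ, 0 ≤ psiField Wbar ρ n x i := by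
  unfold psiField
  split_ifs with hi
  · set e := Function.Embedding.subtype (· ∈ ball n)
    have hw := (isWeight_dysonWeight hW hρ).comp e
    have h := ae_posDef_pinnedMeasure hw.symm fun i => totalWeight Wbar ρ (e i)
    rw [← hμ e] at h
    filter_upwards [ae_of_ae_map (Measurable.aemeasurable (by fun_prop)) h] with x hx
    exact greenField_nonneg hw.nonneg (fun i => (boundaryWeight_dyson_pos hW hρ e i).le) hx _
  · exact ae_of_all _ fun _ => zero_le_one

/-- The martingale property, in terms of lower integrals. -/
theorem setLIntegral_psiField (hW : 0 < Wbar) (hρ : 1 < ρ) (hμ : HasDysonMarginals Wbar ρ μ)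
    {n m : ℕ} (hnm : n ≤ m) {i : ℕ+} (hi : i ∈ ball n) {S : Set (ball n → ℝ)}
    (hS : MeasurableSet S) :
    ∫⁻ x in (fun (x : ℕ+ → ℝ) (j : ball n) => x j) ⁻¹' S, ENNReal.ofReal (psiField Wbar ρ m x i) ∂μ =
      ∫⁻ y in S, ENNReal.ofReal (greenField (fun j k : ball n => dysonWeight Wbar ρ j k)
        (fun j => totalWeight Wbar ρ j) y ⟨i, hi⟩)
        ∂pinnedMeasure (fun j k : ball n => dysonWeight Wbar ρ j k)
          fun j => totalWeight Wbar ρ j := by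
  set em := Function.Embedding.subtype (· ∈ ball m)
  set e : ball n ↪ ball m := ⟨fun j => ⟨j, ball_mono hnm j.2⟩, fun j k h =>
    Subtype.ext (congrArg (fun y : ball m => (y : ℕ+)) h)⟩
  have hdw := isWeight_dysonWeight hW hρ
  have hg : Measurable (S.indicator (1 : (ball n → ℝ) → ENNReal)) := measurable_one.indicator hS
  have hgm := measurable_greenField_apply (fun j k => dysonWeight Wbar ρ (em j) (em k))
    (fun j => totalWeight Wbar ρ (em j)) (e ⟨i, hi⟩)
  have hgn := measurable_greenField_apply (fun j k : ball n => dysonWeight Wbar ρ j k)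
    (fun j => totalWeight Wbar ρ j) ⟨i, hi⟩
  have h := lintegral_greenField_comp (hdw.comp em) (boundaryWeight_dyson_pos hW hρ em) e ⟨i, hi⟩ hg
  have hge : Measurable fun y : ball m → ℝ => S.indicator (1 : (ball n → ℝ) → ENNReal)
      fun j => y (e j) := hg.comp (by fun_prop)
  have hprod : Measurable fun y => ENNReal.ofReal
      (greenField (fun j k => dysonWeight Wbar ρ (em j) (em k))
        (fun j => totalWeight Wbar ρ (em j)) y (e ⟨i, hi⟩)) *
      S.indicator (1 : (ball n → ℝ) → ENNReal) fun j => y (e j) := hgm.ennreal_ofReal.mul hge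
  rw [← lintegral_pinnedMeasure (hdw.comp em).symm _ hprod, ← hμ em,
    lintegral_map hprod (by fun_prop)] at h
  rw [← lintegral_indicator hS, ← lintegral_indicator (hS.preimage (by fun_prop)),
    lintegral_pinnedMeasure (hdw.comp fun j : ball n => (j : ℕ+)).symm _
      (hgn.ennreal_ofReal.indicator hS)]
  refine Eq.trans (lintegral_congr fun x => ?_) (h.trans (lintegral_congr fun y => ?_))
  · by_cases hx : (fun j : ball n => x j) ∈ S
    · rw [Set.indicator_of_mem (by exact hx), Set.indicator_of_mem (by exact hx), Pi.one_apply,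
        mul_one, psiField, dif_pos (ball_mono hnm hi)]
      rfl
    · rw [Set.indicator_of_notMem (by exact hx), Set.indicator_of_notMem (by exact hx), mul_zero]
  · by_cases hy : y ∈ S
    · rw [Set.indicator_of_mem hy, Set.indicator_of_mem hy, Pi.one_apply, mul_one]
      rfl
    · rw [Set.indicator_of_notMem hy, Set.indicator_of_notMem hy, mul_zero, mul_zero, mul_zero]

theorem lintegral_psiField (hW : 0 < Wbar) (hρ : 1 < ρ) (hμ : HasDysonMarginals Wbar ρ μ)
    {n : ℕ} {i : ℕ+} (hi : i ∈ ball n) :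
    ∫⁻ x, ENNReal.ofReal (psiField Wbar ρ n x i) ∂μ = 1 := by
  have h := setLIntegral_psiField hW hρ hμ le_rfl hi MeasurableSet.univ
  rw [Set.preimage_univ, Measure.restrict_univ, Measure.restrict_univ] at h
  rw [h]
  exact lintegral_greenField ((isWeight_dysonWeight hW hρ).comp _)
    (boundaryWeight_dyson_pos hW hρ (Function.Embedding.subtype (· ∈ ball n))) _

theorem eLpNorm_psiField (hW : 0 < Wbar) (hρ : 1 < ρ) (hμ : HasDysonMarginals Wbar ρ μ)
    {n : ℕ} {i : ℕ+} (hi : i ∈ ball n) : eLpNorm (fun x => psiField Wbar ρ n x i) 1 μ = 1 := by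
  rw [eLpNorm_one_eq_lintegral_enorm, ← lintegral_psiField hW hρ hμ hi]
  refine lintegral_congr_ae ?_
  filter_upwards [psiField_nonneg_ae hW hρ hμ n i] with x hx
  exact Real.enorm_of_nonneg hx

/-- The filtration generated by the potential on the balls `Λ_{n + k}`, `k ≥ 0`. -/
def ballFiltration (n : ℕ) : Filtration ℕ (inferInstance : MeasurableSpace (ℕ+ → ℝ)) where
  seq k := MeasurableSpace.comap (fun (x : ℕ+ → ℝ) (j : ball (n + k)) => x j) inferInstance
  mono' k l hkl := by
    rintro _ ⟨S, hS, rfl⟩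
    have hsub := ball_mono (Nat.add_le_add_left hkl n)
    exact ⟨(fun (y : ball (n + l) → ℝ) (j : ball (n + k)) => y ⟨j, hsub j.2⟩) ⁻¹' S,
      hS.preimage (by fun_prop), rfl⟩
  le' k := (show Measurable fun (x : ℕ+ → ℝ) (j : ball (n + k)) => x j by fun_prop).comap_le

theorem martingale_psiField (hW : 0 < Wbar) (hρ : 1 < ρ) [IsProbabilityMeasure μ]
    (hμ : HasDysonMarginals Wbar ρ μ) {n : ℕ} {i : ℕ+} (hi : i ∈ ball n) :
    Martingale (fun k x => psiField Wbar ρ (n + k) x i) (ballFiltration n) μ := by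
  -- Starting at a ball that contains i avoids the default value 1.
  have hmem : ∀ k, i ∈ ball (n + k) := fun k => ball_mono (Nat.le_add_right n k) hi
  refine martingale_of_setIntegral_eq_succ (fun k => ?_) (fun k => ?_) fun k s hs => ?_
  · refine Measurable.stronglyMeasurable ?_
    simp only [psiField, dif_pos (hmem k)]
    exact (measurable_greenField_apply _ _ _).comp (comap_measurable _)
  · refine memLp_one_iff_integrable.1 ⟨(measurable_psiField _ _ _ _).aestronglyMeasurable, ?_⟩
    rw [eLpNorm_psiField hW hρ hμ (hmem k)]
    exact ENNReal.one_lt_top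
  · obtain ⟨S, hS, rfl⟩ := hs
    rw [integral_eq_lintegral_of_nonneg_ae
        (ae_restrict_of_ae (psiField_nonneg_ae hW hρ hμ _ i))
        (measurable_psiField _ _ _ _).aestronglyMeasurable,
      integral_eq_lintegral_of_nonneg_ae
        (ae_restrict_of_ae (psiField_nonneg_ae hW hρ hμ _ i))
        (measurable_psiField _ _ _ _).aestronglyMeasurable,
      setLIntegral_psiField hW hρ hμ le_rfl (hmem k) hS,
      setLIntegral_psiField hW hρ hμ (show n + k ≤ n + (k + 1) by omega) (hmem k) hS]

/-- The limit of the fields `psiField`. -/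
def psiLimit (Wbar ρ : ℝ) (x : ℕ+ → ℝ) (i : ℕ+) : ℝ :=
  limsup (fun n => psiField Wbar ρ n x i) atTop

theorem measurable_psiLimit (Wbar ρ : ℝ) : Measurable (psiLimit Wbar ρ) := by
  refine measurable_pi_lambda _ fun i => ?_
  simp only [psiLimit]
  exact Measurable.limsup fun n => measurable_psiField Wbar ρ n i

/-- A nonnegative martingale of mean one is bounded in L¹, and Doob's theorem applies. -/
theorem tendsto_psiField (hW : 0 < Wbar) (hρ : 1 < ρ) [IsProbabilityMeasure μ]
    (hμ : HasDysonMarginals Wbar ρ μ) :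
    ∀ᵐ x ∂μ, ∀ i, Tendsto (fun n => psiField Wbar ρ n x i) atTop (𝓝 (psiLimit Wbar ρ x i)) := by
  refine ae_all_iff.2 fun i => ?_
  obtain ⟨n, hn⟩ := (eventually_subset_ball {i}).exists
  have hi : i ∈ ball n := hn (by simp)
  have hbdd : ∀ k, eLpNorm (fun x => psiField Wbar ρ (n + k) x i) 1 μ ≤ ((1 : NNReal) : ENNReal) :=
    fun k => by
      rw [eLpNorm_psiField hW hρ hμ (ball_mono (Nat.le_add_right n k) hi), ENNReal.coe_one]
  have hconv :=
    (martingale_psiField hW hρ hμ hi).submartingale.exists_ae_tendsto_of_bdd hbdd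
  filter_upwards [hconv] with x hx
  obtain ⟨c, hc⟩ := hx
  have h := (tendsto_add_atTop_iff_nat (f := fun n => psiField Wbar ρ n x i) n).1
    (hc.congr fun k => by rw [add_comm])
  rw [psiLimit, h.limsup_eq]
  exact h

/-- The approximations agree from some n on, so their limsups agree for every x, whether or not they
converge. -/
theorem psiLimit_comp {σ : Equiv.Perm ℕ+} (hσ : σ ∈ autGroup) (x : ℕ+ → ℝ) :
    psiLimit Wbar ρ (fun j => x (σ j)) = fun i => psiLimit Wbar ρ x (σ i) := by
  ext i
  refine limsup_congr ?_
  filter_upwards [eventually_subset_ball {σ 1}] with n hn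
  exact psiField_comp hσ (hn (by simp)) x i

/-- An equivariant image of a stationary and ergodic field is stationary and ergodic. -/
theorem StationaryErgodic.map {Γ : Subgroup (Equiv.Perm ℕ+)} (h : StationaryErgodic Γ μ)
    {Ψ : (ℕ+ → ℝ) → ℕ+ → ℝ} (hΨ : Measurable Ψ)
    (hcomp : ∀ σ ∈ Γ, ∀ x, Ψ (fun j => x (σ j)) = fun i => Ψ x (σ i)) :
    StationaryErgodic Γ (μ.map Ψ) := by
  have heq : ∀ (c : DomMulAct Γ) (x : ℕ+ → ℝ), Ψ (c • x) = c • Ψ x := fun c x =>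
    hcomp _ (DomMulAct.mk.symm c).2 x
  have hm : ∀ c : DomMulAct Γ, Measurable fun x : ℕ+ → ℝ => c • x := fun c =>
    measurable_pi_lambda _ fun i => measurable_pi_apply _
  have hpre : ∀ (c : DomMulAct Γ) (s : Set (ℕ+ → ℝ)),
      Ψ ⁻¹' ((c • ·) ⁻¹' s) = (c • ·) ⁻¹' (Ψ ⁻¹' s) := fun c s => by
    ext x
    simp only [Set.mem_preimage, heq]
  have h' : ErgodicSMul (DomMulAct Γ) (ℕ+ → ℝ) μ := h
  refine ErgodicSMul.mk (toSMulInvariantMeasure := ⟨fun c s hs => ?_⟩) fun {s} hs hinv => ?_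
  · rw [Measure.map_apply hΨ (hs.preimage (hm c)), Measure.map_apply hΨ hs, hpre]
    exact h'.measure_preimage_smul c (hΨ hs)
  · have h0 : ∀ c : DomMulAct Γ, (c • ·) ⁻¹' (Ψ ⁻¹' s) =ᵐ[μ] Ψ ⁻¹' s := fun c => by
      rw [← hpre]
      exact (hΨ.quasiMeasurePreserving μ).preimage_ae_eq (hinv c)
    have h1 := h'.aeconst_of_forall_preimage_smul_ae_eq (hΨ hs) h0
    rw [eventuallyConst_set] at h1 ⊢
    exact h1.imp (ae_map_iff hΨ.aemeasurable hs).2 (ae_map_iff hΨ.aemeasurable hs.compl).2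

end PsiField

end DysonH22

end

/-! ### The main theorem. -/

theorem mainTheorem8
    {Ω : Type*} [MeasurableSpace Ω] (P : Measure Ω) [IsProbabilityMeasure P]
    (Wbar ρ : ℝ) (hW : 0 < Wbar) (hρ : 1 < ρ)
    (β : Ω → ℕ+ → ℝ) (βδ : ℕ → Ω → ℝ)
    (hβ : ∀ n : ℕ, HasLaw (fun ω => DysonH22.augment n (β ω) (βδ n ω))
      (DysonH22.h22Measure (DysonH22.wiredWeight Wbar ρ n)) P) :
    AEMeasurable β P ∧
    DysonH22.StationaryErgodic DysonH22.swapGroup (P.map β) ∧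
    DysonH22.StationaryErgodic DysonH22.autGroup (P.map β) ∧
    (∀ E F : Set (ℕ+ → ℝ), MeasurableSet E → MeasurableSet F →
      Tendsto (fun n : ℕ => P.map β ({x | (fun i => x (DysonH22.swap n i)) ∈ F} ∩ E))
        atTop (𝓝 (P.map β F * P.map β E))) ∧
    ∃ ψ : Ω → ℕ+ → ℝ, AEMeasurable ψ P ∧
      (∀ᵐ ω ∂P, ∀ i, Tendsto
        (fun n : ℕ => DysonH22.psiApprox Wbar ρ n (β ω) (βδ n ω) i) atTop (𝓝 (ψ ω i))) ∧
      DysonH22.StationaryErgodic DysonH22.swapGroup (P.map ψ) ∧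
      DysonH22.StationaryErgodic DysonH22.autGroup (P.map ψ) := by
  have hm : AEMeasurable β P := DysonH22.aemeasurable_of_hasLaw hβ
  have hμ := DysonH22.hasDysonMarginals_of_hasLaw hW hρ hβ
  have : IsProbabilityMeasure (P.map β) := Measure.isProbabilityMeasure_map hm
  -- Stationarity needs only that Γ consists of automorphisms; mixing then gives ergodicity once Γ
  -- contains every g_n.
  have herg : ∀ Γ : Subgroup (Equiv.Perm ℕ+), DysonH22.swapGroup ≤ Γ → Γ ≤ DysonH22.autGroup →
      DysonH22.StationaryErgodic Γ (P.map β) := fun Γ h1 h2 =>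
    DysonH22.stationaryErgodic_of_mixing (fun n => h1 (Subgroup.subset_closure ⟨n, rfl⟩))
      (fun σ hσ => DysonH22.measurePreserving_of_mem_autGroup hμ (h2 hσ))
      fun E hE => DysonH22.mixing_swap hW hρ hμ hE hE
  have hβG := herg _ le_rfl DysonH22.swapGroup_le_autGroup
  have hβA := herg _ DysonH22.swapGroup_le_autGroup le_rfl
  have hΨ := DysonH22.measurable_psiLimit Wbar ρ
  refine ⟨hm, hβG, hβA, fun E F hE hF => DysonH22.mixing_swap hW hρ hμ hE hF,
    fun ω => DysonH22.psiLimit Wbar ρ (β ω), hΨ.comp_aemeasurable hm, ?_, ?_⟩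
  · have hpos : ∀ᵐ ω ∂P, ∀ n, (DysonH22.schrodinger (DysonH22.wiredWeight Wbar ρ n)
        (DysonH22.augment n (β ω) (βδ n ω))).PosDef := by
      refine ae_all_iff.2 fun n => ?_
      have h := DysonH22.ae_posDef_pinnedMeasure (DysonH22.isWeight_wiredWeight hW hρ n).symm
        fun i => ∑ j, DysonH22.wiredWeight Wbar ρ n i j
      rw [← DysonH22.h22Measure_eq_pinnedMeasure, ← (hβ n).map_eq] at h
      exact ae_of_ae_map (hβ n).aemeasurable h
    filter_upwards [hpos, ae_of_ae_map hm (DysonH22.tendsto_psiField hW hρ hμ)] with ω h1 h2 i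
    simpa only [DysonH22.psiApprox_eq_psiField hW hρ (h1 _)] using h2 i
  · have hmap : P.map (fun ω => DysonH22.psiLimit Wbar ρ (β ω)) =
        (P.map β).map (DysonH22.psiLimit Wbar ρ) :=
      (AEMeasurable.map_map_of_aemeasurable hΨ.aemeasurable hm).symm
    rw [hmap]
    exact ⟨hβG.map hΨ fun σ hσ => DysonH22.psiLimit_comp (DysonH22.swapGroup_le_autGroup hσ),
      hβA.map hΨ fun σ hσ => DysonH22.psiLimit_comp hσ⟩
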